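/- Consider the call-by-value $\lambda$-calculus with shift as a value and reset. Terms, taken modulo $\alpha$-conversion, and values are $t,s ::= v \mid t\,s \mid \langle t\rangle$ and $v,w ::= x \mid \lambda x.t \mid \mathcal S$; pure contexts are $E ::= \square \mid v\,E \mid E\,t$, and evaluation contexts are $F ::= \square \mid v\,F \mid F\,t \mid \langle F\rangle$. A term is pure if it is a value or of the form $\langle t\rangle$. Reduction is $F[(\lambda x.t)\,v]\to F[t\{v/x\}]$, $F[\langle E[\mathcal S\,v]\rangle]\to F[\langle v\,(\lambda x.\langle E[x]\rangle)\rangle]$ ($x\notin \mathrm{fv}(E)$), $F[\langle v\rangle]\to F[v]$; $\to^*$ is its reflexive transitive closure, and $t\Downarrow s$ means that $t\to^* s$ and $s$ does not reduce. For a relation $R$ on terms, with $x$ a fresh variable in each rule: $v\,R^{v}\,w$ if $v\,x\,R\,w\,x$; $E\,R^{c}\,E'$ if $E[x]\,R\,E'[x]$; $F[\langle E\rangle]\,R^{c}\,F'[\langle E'\rangle]$ if $\langle E[x]\rangle\,R\,\langle E'[x]\rangle$ and $F[x]\,R\,F'[x]$; $F[y\,v]\,R^{o}\,F'[y\,w]$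 if $F\,R^{c}\,F'$ and $v\,R^{v}\,w$; $E[\mathcal S\,v]\,R^{s}\,E'[\mathcal S\,w]$ if $E\,R^{c}\,E'$ and $\langle v\,x\rangle\,R\,\langle w\,x\rangle$. Write $R\rightarrowtail S,T$ if $R\subseteq S\subseteq T$ and, whenever $t\,R\,s$: (i) if $t\to t'$, then $s\to^* s'$ and $t'\,T\,s'$ for some $s'$; (ii) if $t$ is a value, then $s\Downarrow w$ for a value $w$ with $t\,S^{v}\,w$; (iii) if $t=F[y\,v]$, then $s\Downarrow F'[y\,w]$ for some $F',w$ with $t\,T^{o}\,F'[y\,w]$; (iv) if $t=E[\mathcal S\,v]$, then $s\Downarrow E'[\mathcal S\,w]$ for some $E',w$ with $t\,T^{s}\,E'[\mathcal S\,w]$; and the converse conditions on $s$. A bisimulation is an $R$ with $R\rightarrowtail R,R$; bisimilarity $\approx$ is the union of all bisimulations. Let $f,g,h$ be functions on relations. Such an $f$ is an up-to technique (resp. strong up-to technique) if $R\rightarrowtail R,f(R)$ (resp. $R\rightarrowtail f(R),f(R)$) implies $R\subseteq{\approx}$; it is continuous if $f(R)$ is always the union of the $f(R_0)$ over finite $R_0\subseteq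 R$; $f$ evolves to $g,h$ if $R\rightarrowtail R,T$ implies $f(R)\rightarrowtail g(R),h(T)$, and strongly evolves to $g,h$ if $R\rightarrowtail S,T$ implies $f(R)\rightarrowtail g(S),h(T)$. Put $\hat f=f\cup\mathsf{id}$ and $f^\omega=\bigcup_n f^n$; a set of functions also denotes the union of its elements. A set $\mathcal F$ of continuous functions is diacritically compatible if some $\mathcal S\subseteq\mathcal F$ is such that (a) each $f\in\mathcal S$ strongly evolves to $\hat{\mathcal S}^\omega,\hat{\mathcal F}^\omega$, and (b) each $f\in\mathcal F$ evolves to $\hat{\mathcal S}^\omega\circ\hat{\mathcal F}\circ\hat{\mathcal S}^\omega,\hat{\mathcal F}^\omega$. The largest such $\mathcal S$ is written $\mathsf{strong}(\mathcal F)$. A function is generated from $\mathcal F$ if it is built from elements of $\mathcal F$ and $\mathsf{id}$ by union, composition and $\cdot^\omega$. Let $\mathcal F=\{\mathsf{refl},\mathsf{lam},\mathsf{subst},\mathsf{pctx},\mathsf{pctxrst},\mathsf{ectxpure},\mathsf{id},\mathsf{red}\}$, where $\mathsf{id}(R)=R$ and: - $t\ \mathsf{refl}(R)\ t$ for all $t$;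 - $\lambda x.t\ \mathsf{lam}(R)\ \lambda x.s$ if $t\,R\,s$; - $t\{v/x\}\ \mathsf{subst}(R)\ s\{w/x\}$ if $t\,R\,s$ and $v\,R^{v}\,w$; - $E[t]\ \mathsf{pctx}(R)\ E'[s]$ if $t\,R\,s$ and $E\,R^{c}\,E'$; - $\langle E[t]\rangle\ \mathsf{pctxrst}(R)\ \langle E'[s]\rangle$ if $t\,R\,s$ and $\langle E\rangle\,R^{c}\,\langle E'\rangle$; - $F[t]\ \mathsf{ectxpure}(R)\ F'[s]$ if $t\,R\,s$, $t$ and $s$ are pure and $F[x]\,R\,F'[x]$ for a fresh $x$; - $t\ \mathsf{red}(R)\ s$ if $t\to^*t'$, $s\to^*s'$ and $t'\,R\,s'$ for some $t',s'$. Theorem. $\mathcal F$ is diacritically compatible, with $\mathsf{strong}(\mathcal F)=\mathcal F\setminus\{\mathsf{pctx},\mathsf{pctxrst},\mathsf{ectxpure}\}$. Consequently, with $\mathcal S=\mathsf{strong}(\mathcal F)$: 1. if $R\rightarrowtail\hat{\mathcal S}^\omega(R),\hat{\mathcal F}^\omega(R)$, then $\hat{\mathcal F}^\omega(R)$ is a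 bisimulation; every function generated from $\mathcal F$ (resp. $\mathcal S$) is an up-to technique (resp. a strong up-to technique); and $f(\approx)\subseteq{\approx}$ for every $f\in\mathcal F$; 2. $\approx$ is a congruence: an equivalence relation preserved by all (capturing) one-hole contexts $C$; 3. $\approx$ is sound: if $t\approx s$, then $t$ and $s$ are contextually equivalent, i.e. for every $C$ such that $C[t]$ and $C[s]$ are closed, evaluation of $C[t]$ terminates (resp. yields a value, resp. yields a control-stuck term $E[\mathcal S\,v]$) if and only if that of $C[s]$ does; 4. up to context, $\mathsf{ctx}(R)=\{(C[t],C[s])\mid t\,R\,s\}$, is contained in $\hat{\mathcal F}^\omega$ and is an up-to technique for $\approx$, while $\approx$ satisfies the $\eta$-law $\lambda x.v\,x\approx v$ for every value $v$ and $x\notin\mathrm{fv}(v)$. -/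

import Mathlib

namespace ShiftReset

/-! ## Terms

Terms are taken modulo `α`-conversion, through de Bruijn indices.  A variable `var n` that points
outside of all the binders above it is a free variable; the names of the variables of the calculus
are the natural numbers, and the free variable `n` is written `var n` at top level and
`var (n + k)` under `k` binders. -/

/-- Terms of the call-by-value `λ`-calculus with `shift` (a value) and `reset`. -/
inductive Tm : Type
  | var (n : ℕ) : Tm
  | lam (t : Tm) : Tm
  | shift : Tm
  | app (t s : Tm) : Tm
  | reset (t : Tm) : Tm

namespace Tm

/-- Values: variables, abstractions and `shift`. -/
def IsValue : Tm → Prop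
  | var _ => True
  | lam _ => True
  | shift => True
  | app _ _ => False
  | reset _ => False

/-- Pure terms: values and terms of the form `⟨t⟩`. -/
def IsPure : Tm → Prop
  | app _ _ => False
  | _ => True

/-- The set of free variables of a term. -/
def fv : Tm → Set ℕ
  | var n => {n}
  | lam t => {n | n + 1 ∈ t.fv}
  | shift => ∅
  | app t s => t.fv ∪ s.fv
  | reset t => t.fv

def Closed (t : Tm) : Prop := t.fv = ∅

/-- Extension of a renaming under a binder. -/
def liftRen (ρ : ℕ → ℕ) : ℕ → ℕ
  | 0 => 0
  | n + 1 => ρ n + 1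

/-- Renaming of free variables. -/
def rename : (ℕ → ℕ) → Tm → Tm
  | ρ, var n => var (ρ n)
  | ρ, lam t => lam (rename (liftRen ρ) t)
  | _, shift => shift
  | ρ, app t s => app (rename ρ t) (rename ρ s)
  | ρ, reset t => reset (rename ρ t)

/-- Extension of a substitution under a binder. -/
def liftSub (σ : ℕ → Tm) : ℕ → Tm
  | 0 => var 0
  | n + 1 => rename Nat.succ (σ n)

/-- Simultaneous capture-avoiding substitution. -/
def bind : (ℕ → Tm) → Tm → Tm
  | σ, var n => σ n
  | σ, lam t => lam (bind (liftSub σ) t)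
  | _, shift => shift
  | σ, app t s => app (bind σ t) (bind σ s)
  | σ, reset t => reset (bind σ t)

/-- `t{v/x}`: capture-avoiding substitution of `v` for the free variable `x` in `t`. -/
def subst (t : Tm) (x : ℕ) (v : Tm) : Tm :=
  bind (fun y => if y = x then v else var y) t

/-- `λx.t` for a named variable `x`: the free variable `x` of `t` becomes bound. -/
def abs (x : ℕ) (t : Tm) : Tm :=
  lam (rename (fun y => if y = x then 0 else y + 1) t)

/-- Contraction of the body `t` of an abstraction `lam t`: the bound variable is replaced by `v`. -/
def inst (t v : Tm) : Tm :=
  bind (fun n => match n with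
    | 0 => v
    | n + 1 => var n) t

theorem IsValue.rename {v : Tm} (hv : v.IsValue) (ρ : ℕ → ℕ) : (v.rename ρ).IsValue := by
  cases v <;> first | exact trivial | exact hv.elim

end Tm

/-! ## Evaluation contexts -/

/-- Evaluation contexts `F ::= □ | v F | F t | ⟨F⟩`, represented outside-in. -/
inductive ECtx : Type
  | hole : ECtx
  | appR (v : Tm) (hv : v.IsValue) (F : ECtx) : ECtx
  | appL (F : ECtx) (t : Tm) : ECtx
  | reset (F : ECtx) : ECtx

namespace ECtx

/-- Pure contexts `E ::= □ | v E | E t`: the evaluation contexts with no `reset` around the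
hole. -/
def Pure : ECtx → Prop
  | hole => True
  | appR _ _ F => F.Pure
  | appL F _ => F.Pure
  | reset _ => False

/-- `F[t]`. -/
def plug : ECtx → Tm → Tm
  | hole, t => t
  | appR v _ F, t => .app v (F.plug t)
  | appL F s, t => .app (F.plug t) s
  | reset F, t => .reset (F.plug t)

/-- `F[G]`: the context obtained by plugging the context `G` into the hole of `F`. -/
def comp : ECtx → ECtx → ECtx
  | hole, G => G
  | appR v hv F, G => appR v hv (F.comp G)
  | appL F s, G => appL (F.comp G) s
  | reset F, G => reset (F.comp G)

def fv : ECtx → Set ℕ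
  | hole => ∅
  | appR v _ F => v.fv ∪ F.fv
  | appL F t => F.fv ∪ t.fv
  | reset F => F.fv

def rename (ρ : ℕ → ℕ) : ECtx → ECtx
  | hole => hole
  | appR v hv F => appR (v.rename ρ) (hv.rename ρ) (F.rename ρ)
  | appL F t => appL (F.rename ρ) (t.rename ρ)
  | reset F => reset (F.rename ρ)

/-- `λx.⟨E[x]⟩` with `x` not free in `E`: the captured context as a value. -/
def reify (E : ECtx) : Tm :=
  .lam (.reset ((E.rename Nat.succ).plug (.var 0)))

end ECtx

/-! ## Reduction -/

/-- Call-by-value left-to-right reduction. -/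
inductive Step : Tm → Tm → Prop
  | beta (F : ECtx) (t v : Tm) : v.IsValue →
      Step (F.plug (.app (.lam t) v)) (F.plug (t.inst v))
  | capture (F E : ECtx) (v : Tm) : E.Pure → v.IsValue →
      Step (F.plug (.reset (E.plug (.app .shift v)))) (F.plug (.reset (.app v E.reify)))
  | reset (F : ECtx) (v : Tm) : v.IsValue →
      Step (F.plug (.reset v)) (F.plug v)

/-- Reflexive and transitive closure of reduction. -/
def Steps : Tm → Tm → Prop := Relation.ReflTransGen Step

/-- `t` evaluates to `s`. -/
def EvalsTo (t s : Tm) : Prop := Steps t s ∧ ∀ u, ¬ Step s u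

/-- Control-stuck terms `E[shift v]`. -/
def ControlStuck (t : Tm) : Prop :=
  ∃ (E : ECtx) (v : Tm), E.Pure ∧ v.IsValue ∧ t = E.plug (.app .shift v)

/-! ## Testing of normal forms

As in any inference rule with finitely many premises, a premise with a fresh variable asks for one
variable that does not occur in the values or contexts which are compared. -/

/-- Relations on terms. -/
abbrev TmRel : Type := Tm → Tm → Prop

/-- Testing of values: `v x R w x` for a fresh `x`. -/
def TestVal (R : TmRel) (v w : Tm) : Prop :=
  v.IsValue ∧ w.IsValue ∧
    ∃ x : ℕ, x ∉ v.fv ∧ x ∉ w.fv ∧ R (.app v (.var x)) (.app w (.var x))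

/-- Testing of evaluation contexts. -/
inductive TestCtx (R : TmRel) : ECtx → ECtx → Prop
  | pure (E E' : ECtx) (x : ℕ) : E.Pure → E'.Pure → x ∉ E.fv → x ∉ E'.fv →
      R (E.plug (.var x)) (E'.plug (.var x)) →
      TestCtx R E E'
  | reset (F F' E E' : ECtx) (x : ℕ) : E.Pure → E'.Pure →
      x ∉ F.fv → x ∉ F'.fv → x ∉ E.fv → x ∉ E'.fv →
      R (.reset (E.plug (.var x))) (.reset (E'.plug (.var x))) →
      R (F.plug (.var x)) (F'.plug (.var x)) →
      TestCtx R (F.comp (.reset E)) (F'.comp (.reset E'))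

/-- Testing of open stuck terms `F[x v]`. -/
inductive TestOpen (R : TmRel) : Tm → Tm → Prop
  | mk (F F' : ECtx) (x : ℕ) (v w : Tm) : TestCtx R F F' → TestVal R v w →
      TestOpen R (F.plug (.app (.var x) v)) (F'.plug (.app (.var x) w))

/-- Testing of control-stuck terms `E[shift v]`. -/
inductive TestCtrl (R : TmRel) : Tm → Tm → Prop
  | mk (E E' : ECtx) (v w : Tm) (x : ℕ) : E.Pure → E'.Pure → v.IsValue → w.IsValue →
      TestCtx R E E' → x ∉ v.fv → x ∉ w.fv →
      R (.reset (.app v (.var x))) (.reset (.app w (.var x))) →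
      TestCtrl R (E.plug (.app .shift v)) (E'.plug (.app .shift w))

/-! ## Diacritical progress and bisimilarity -/

/-- The clauses of progress on the left-hand terms of `R`; the value clause is passive and uses
`S`, the other clauses are active and use `T`. -/
def HalfProgress (R S T : TmRel) : Prop :=
  ∀ t s, R t s →
    (∀ t', Step t t' → ∃ s', Steps s s' ∧ T t' s') ∧
    (t.IsValue → ∃ w, w.IsValue ∧ EvalsTo s w ∧ TestVal S t w) ∧
    (∀ F x v, v.IsValue → t = ECtx.plug F (.app (.var x) v) →
      ∃ F' w, w.IsValue ∧ EvalsTo s (ECtx.plug F' (.app (.var x) w)) ∧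
        TestOpen T (F.plug (.app (.var x) v)) (F'.plug (.app (.var x) w))) ∧
    (∀ E v, ECtx.Pure E → v.IsValue → t = E.plug (.app .shift v) →
      ∃ E' w, ECtx.Pure E' ∧ w.IsValue ∧ EvalsTo s (E'.plug (.app .shift w)) ∧
        TestCtrl T (E.plug (.app .shift v)) (E'.plug (.app .shift w)))

/-- `R` diacritically progresses to `S`, `T`. -/
def Progress (R S T : TmRel) : Prop :=
  R ≤ S ∧ S ≤ T ∧ HalfProgress R S T ∧
    HalfProgress (Function.swap R) (Function.swap S) (Function.swap T)

def IsBisimulation (R : TmRel) : Prop := Progress R R R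

/-- Extensional normal-form bisimilarity: the union of all normal-form bisimulations. -/
def Bisim : TmRel := fun t s => ∃ R, IsBisimulation R ∧ R t s

/-! ## Functions on relations, up-to techniques, compatibility -/

/-- Functions on relations. -/
abbrev RelFun : Type := TmRel → TmRel

/-- `f` is an up-to technique. -/
def IsUpTo (f : RelFun) : Prop := ∀ R, Progress R R (f R) → R ≤ Bisim

/-- `f` is a strong up-to technique. -/
def IsStrongUpTo (f : RelFun) : Prop := ∀ R, Progress R (f R) (f R) → R ≤ Bisim

/-- `f` is determined by its values on finite relations: `f(R)` is the union of the `f(R₀)`, for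
`R₀` a finite subset of `R`. -/
def IsContinuous (f : RelFun) : Prop :=
  ∀ R t s, f R t s ↔
    ∃ R₀ : TmRel, R₀ ≤ R ∧ {p : Tm × Tm | R₀ p.1 p.2}.Finite ∧ f R₀ t s

/-- The function `f ∪ id`. -/
def hat (f : RelFun) : RelFun := fun R => f R ⊔ R

/-- The function `f^ω`, union of the iterates `f^n` for `n ≥ 0`. -/
def omega (f : RelFun) : RelFun := fun R t s => ∃ n : ℕ, (f^[n]) R t s

/-- A set of functions, seen as the union of its elements. -/
def unionFun (𝓕 : Set RelFun) : RelFun := fun R t s => ∃ f ∈ 𝓕, f R t s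

/-- `(𝓕 ∪ id)^ω`, the largest function generated from `𝓕`. -/
def closure (𝓕 : Set RelFun) : RelFun := omega (hat (unionFun 𝓕))

/-- The functions built from elements of `𝓕` and the identity with union, composition and
`·^ω`. -/
inductive Generated (𝓕 : Set RelFun) : RelFun → Prop
  | mem (f : RelFun) : f ∈ 𝓕 → Generated 𝓕 f
  | id : Generated 𝓕 (fun R => R)
  | union (f g : RelFun) : Generated 𝓕 f → Generated 𝓕 g → Generated 𝓕 (fun R => f R ⊔ g R)
  | comp (f g : RelFun) : Generated 𝓕 f → Generated 𝓕 g → Generated 𝓕 (fun R => f (g R))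
  | omega (f : RelFun) : Generated 𝓕 f → Generated 𝓕 (omega f)

/-- `f` evolves to `g`, `h`. -/
def Evolves (f g h : RelFun) : Prop :=
  ∀ R T, Progress R R T → Progress (f R) (g R) (h T)

/-- `f` strongly evolves to `g`, `h`. -/
def StronglyEvolves (f g h : RelFun) : Prop :=
  ∀ R S T, Progress R S T → Progress (f R) (g S) (h T)

/-- The subset `𝓢` of `𝓕` satisfies the two conditions of diacritical compatibility. -/
def IsStrongPart (𝓕 𝓢 : Set RelFun) : Prop :=
  𝓢 ⊆ 𝓕 ∧
  (∀ f ∈ 𝓢, StronglyEvolves f (closure 𝓢) (closure 𝓕)) ∧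
  (∀ f ∈ 𝓕, Evolves f (fun R => closure 𝓢 (hat (unionFun 𝓕) (closure 𝓢 R))) (closure 𝓕))

/-- Diacritically compatible sets of functions. -/
def DiacriticallyCompatible (𝓕 : Set RelFun) : Prop :=
  (∀ f ∈ 𝓕, IsContinuous f) ∧ ∃ 𝓢, IsStrongPart 𝓕 𝓢

/-! ## The up-to techniques -/

/-- Up to reflexivity. -/
inductive utRefl (R : TmRel) : TmRel
  | mk (t : Tm) : utRefl R t t

/-- Closure under `λ`-abstraction. -/
inductive utLam (R : TmRel) : TmRel
  | mk (x : ℕ) (t s : Tm) : R t s → utLam R (t.abs x) (s.abs x)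

/-- Substitutive closure. -/
inductive utSubst (R : TmRel) : TmRel
  | mk (t s : Tm) (x : ℕ) (v w : Tm) : R t s → TestVal R v w →
      utSubst R (t.subst x v) (s.subst x w)

/-- Closure under related pure contexts. -/
inductive utPctx (R : TmRel) : TmRel
  | mk (t s : Tm) (E E' : ECtx) : R t s → E.Pure → E'.Pure → TestCtx R E E' →
      utPctx R (E.plug t) (E'.plug s)

/-- Closure under related pure contexts surrounded by a `reset`. -/
inductive utPctxReset (R : TmRel) : TmRel
  | mk (t s : Tm) (E E' : ECtx) : R t s → E.Pure → E'.Pure →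
      TestCtx R (.reset E) (.reset E') →
      utPctxReset R (.reset (E.plug t)) (.reset (E'.plug s))

/-- Closure of pure terms under evaluation contexts, compared with a fresh variable. -/
inductive utEctxPure (R : TmRel) : TmRel
  | mk (t s : Tm) (F F' : ECtx) (x : ℕ) : R t s → t.IsPure → s.IsPure →
      x ∉ F.fv → x ∉ F'.fv → R (F.plug (.var x)) (F'.plug (.var x)) →
      utEctxPure R (F.plug t) (F'.plug s)

/-- The identity on relations. -/
def utId : RelFun := fun R => R

/-- Up to reduction. -/
inductive utRed (R : TmRel) : TmRel
  | mk (t s t' s' : Tm) : Steps t t' → Steps s s' → R t' s' → utRed R t s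

/-- The set of up-to techniques for `shift` and `reset`. -/
def techniques : Set RelFun :=
  {utRefl, utLam, utSubst, utPctx, utPctxReset, utEctxPure, utId, utRed}

/-- All the techniques but the three context closures. -/
def strongTechniques : Set RelFun := techniques \ {utPctx, utPctxReset, utEctxPure}

/-! ## Contexts, congruence, contextual equivalence -/

/-- General contexts; the binder of `lam x C` captures the variable `x` of the plugged term. -/
inductive Ctx : Type
  | hole : Ctx
  | lam (x : ℕ) (C : Ctx) : Ctx
  | appL (C : Ctx) (t : Tm) : Ctx
  | appR (t : Tm) (C : Ctx) : Ctx
  | reset (C : Ctx) : Ctx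

/-- `C[t]`. -/
def Ctx.plug : Ctx → Tm → Tm
  | hole, t => t
  | lam x C, t => (C.plug t).abs x
  | appL C s, t => .app (C.plug t) s
  | appR s C, t => .app s (C.plug t)
  | reset C, t => .reset (C.plug t)

/-- Up to context. -/
inductive utCtx (R : TmRel) : TmRel
  | mk (C : Ctx) (t s : Tm) : R t s → utCtx R (C.plug t) (C.plug s)

def IsCongruence (R : TmRel) : Prop :=
  Equivalence R ∧ ∀ (C : Ctx) (t s : Tm), R t s → R (C.plug t) (C.plug s)

/-- Contextual equivalence: no closing context distinguishes the terms by termination of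
evaluation, nor by the kind (value or control-stuck term) of the result. -/
def CtxEquiv (t s : Tm) : Prop :=
  ∀ C : Ctx, (C.plug t).Closed → (C.plug s).Closed →
    ((∃ u, EvalsTo (C.plug t) u) ↔ ∃ u, EvalsTo (C.plug s) u) ∧
    ((∃ v, v.IsValue ∧ EvalsTo (C.plug t) v) ↔ ∃ v, v.IsValue ∧ EvalsTo (C.plug s) v) ∧
    ((∃ u, ControlStuck u ∧ EvalsTo (C.plug t) u) ↔ ∃ u, ControlStuck u ∧ EvalsTo (C.plug s) u)

end ShiftReset

/-!
Each technique `f` is studied by a diagram: given `R ↣ S, T`, a relation `S' ⊇ S` closed under the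
strong techniques and a relation `T' ⊇ T` closed under all the techniques, the pairs of `f R`
satisfy the clauses of progress towards `S'` and `T'` (`halfProgress_subst`, `halfProgress_pctx`
and the others).  Instantiating `S'` and `T'` with closures gives the evolutions; the converse
clauses follow since the techniques commute with taking converses.

Testing is well behaved for a relation closed under the strong techniques: by substitutivity and
reflexivity, a test on one fresh variable is the same as a test on all pairs of related values
(`StrongClosed.app`, `StrongClosed.plugRel_of_fresh`), so freshness plays no role afterwards.  If
moreover the relation is closed under the three context closures, then tested evaluation contexts
preserve the relation and are stable under composition (`FullyClosed.plug`,
`FullyClosed.testCtx_comp`).  The substitutive closure is the heart of the proof: when related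
values `v`, `w` are substituted for the head variable of stuck terms, the resulting `F[v a]` and
`F'[w b]` are simulated by the progress of the test `v x`, `w x`, of which they are instances put in
related contexts (`halfClauses_app`).  This is active progress, where `T'` is available.  For the
context closures, the only case that does not transport clauses through contexts is a value `v` in
the hole; then `F[v]` is an instance of `F[x]` and the substitutive closure applies
(`halfClauses_plug_value`).  There `v` has to be tested with the relation `R` itself, which is why
these closures evolve but do not strongly evolve.

No context closure can be strong: the pair of distinct variables `y`, `z` progresses
passively to the full relation, whereas `y S` and `z S` are open stuck terms with distinct heads
(`not_stronglyEvolves`).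

That bisimulation up to a diacritically compatible set is sound (`IsStrongPart.isBisimulation`) uses
continuity, which makes `closure 𝓕 R` the least relation that contains `R` and is closed under
`𝓕`.  Transitivity of bisimilarity, its stability under contexts and the `η`-law are then
applications of the techniques, and contextual equivalence follows by evaluating bisimilar terms.
-/

namespace ShiftReset

/-! ### Substitution -/

namespace Tm

theorem liftSub_var : liftSub var = var := by
  funext n; cases n <;> rfl

theorem bind_var (t : Tm) : t.bind var = t := by
  induction t with
  | lam t ih => simp only [bind, liftSub_var, ih]
  | _ => simp_all [bind]

theorem rename_eq_bind (t : Tm) (ρ : ℕ → ℕ) : t.rename ρ = t.bind (fun n => var (ρ n)) := by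
  induction t generalizing ρ with
  | lam t ih =>
    have h : (fun n => var (liftRen ρ n)) = liftSub (fun n => var (ρ n)) := by
      funext n; cases n <;> rfl
    simp only [rename, bind, ih, h]
  | _ => simp_all [bind, rename]

theorem bind_of_rename (t : Tm) (ρ : ℕ → ℕ) (σ : ℕ → Tm) :
    (t.rename ρ).bind σ = t.bind (fun n => σ (ρ n)) := by
  induction t generalizing ρ σ with
  | lam t ih =>
    have h : (fun n => liftSub σ (liftRen ρ n)) = liftSub (fun n => σ (ρ n)) := by
      funext n; cases n <;> rfl
    simp only [rename, bind, ih, h]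
  | _ => simp_all [bind, rename]

theorem rename_rename (t : Tm) (ρ ρ' : ℕ → ℕ) :
    (t.rename ρ).rename ρ' = t.rename (fun n => ρ' (ρ n)) := by
  rw [rename_eq_bind _ ρ', bind_of_rename, rename_eq_bind]

theorem rename_of_bind (t : Tm) (σ : ℕ → Tm) (ρ : ℕ → ℕ) :
    (t.bind σ).rename ρ = t.bind (fun n => (σ n).rename ρ) := by
  induction t generalizing ρ σ with
  | lam t ih =>
    have h : (fun n => (liftSub σ n).rename (liftRen ρ)) =
        liftSub (fun n => (σ n).rename ρ) := by
      funext n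
      cases n with
      | zero => rfl
      | succ n => simp only [liftSub, rename_rename]; rfl
    simp only [rename, bind, ih, h]
  | _ => simp_all [bind, rename]

theorem bind_bind (t : Tm) (σ τ : ℕ → Tm) :
    (t.bind σ).bind τ = t.bind (fun n => (σ n).bind τ) := by
  induction t generalizing σ τ with
  | lam t ih =>
    have h : (fun n => (liftSub σ n).bind (liftSub τ)) = liftSub (fun n => (σ n).bind τ) := by
      funext n
      cases n with
      | zero => rfl
      | succ n => simp only [liftSub, bind_of_rename, rename_of_bind]
    simp only [bind, ih, h]
  | _ => simp_all [bind]

theorem bind_congr {t : Tm} {σ τ : ℕ → Tm} (h : ∀ n ∈ t.fv, σ n = τ n) :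
    t.bind σ = t.bind τ := by
  induction t generalizing σ τ with
  | var n => exact h n rfl
  | lam t ih =>
    simp only [bind]
    rw [ih]
    intro n hn
    cases n with
    | zero => rfl
    | succ n => simp only [liftSub, h n hn]
  | shift => rfl
  | app t s iht ihs =>
    simp only [bind]
    rw [iht fun n hn => h n (Or.inl hn), ihs fun n hn => h n (Or.inr hn)]
  | reset t ih =>
    simp only [bind]
    rw [ih h]

theorem fv_finite (t : Tm) : t.fv.Finite := by
  induction t with
  | var n => exact Set.finite_singleton n
  | lam t ih => exact ih.preimage (Nat.succ_injective.injOn)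
  | shift => exact Set.finite_empty
  | app t s iht ihs => exact iht.union ihs
  | reset t ih => exact ih

/-- The substitution that is the identity except at one variable. -/
def single (x : ℕ) (v : Tm) : ℕ → Tm := fun y => if y = x then v else var y

theorem subst_eq_bind (t : Tm) (x : ℕ) (v : Tm) : t.subst x v = t.bind (single x v) := rfl

theorem single_isValue {v : Tm} (hv : v.IsValue) (x n : ℕ) : (single x v n).IsValue := by
  unfold single; split
  · exact hv
  · trivial

theorem subst_of_notMem {t : Tm} {x : ℕ} (h : x ∉ t.fv) (v : Tm) : t.subst x v = t := by
  conv_rhs => rw [← bind_var t]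
  refine bind_congr fun n hn => ?_
  have : n ≠ x := fun e => h (e ▸ hn)
  simp [this]

@[simp] theorem subst_app (t s : Tm) (x : ℕ) (v : Tm) :
    (app t s).subst x v = app (t.subst x v) (s.subst x v) := rfl

@[simp] theorem subst_shift (x : ℕ) (v : Tm) : shift.subst x v = shift := rfl

@[simp] theorem subst_var_self (x : ℕ) (v : Tm) : (var x).subst x v = v := by
  simp [subst, bind]

theorem subst_var_ne {x y : ℕ} (h : y ≠ x) (v : Tm) : (var y).subst x v = var y := by
  simp [subst, bind, h]

theorem IsValue.bind {v : Tm} (hv : v.IsValue) {σ : ℕ → Tm} (hσ : ∀ n, (σ n).IsValue) :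
    (v.bind σ).IsValue := by
  cases v with
  | var n => exact hσ n
  | lam t => trivial
  | shift => trivial
  | app t s => exact hv.elim
  | reset t => exact hv.elim

theorem IsValue.subst {t v : Tm} (ht : t.IsValue) (hv : v.IsValue) (x : ℕ) :
    (t.subst x v).IsValue :=
  ht.bind (single_isValue hv x)

theorem IsValue.isPure {v : Tm} (hv : v.IsValue) : v.IsPure := by
  cases v <;> trivial

/-- The substitution performed by a `β`-step. -/
def head (v : Tm) : ℕ → Tm
  | 0 => v
  | n + 1 => var n

theorem inst_eq_bind (t v : Tm) : t.inst v = t.bind (head v) := by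
  unfold inst
  congr 1

theorem head_isValue {v : Tm} (hv : v.IsValue) (n : ℕ) : (head v n).IsValue := by
  cases n
  · exact hv
  · trivial

theorem liftSub_isValue {σ : ℕ → Tm} (hσ : ∀ n, (σ n).IsValue) (n : ℕ) :
    (liftSub σ n).IsValue := by
  cases n with
  | zero => trivial
  | succ n => exact (hσ n).rename _

theorem bind_inst (t v : Tm) (σ : ℕ → Tm) :
    (t.inst v).bind σ = (t.bind (liftSub σ)).inst (v.bind σ) := by
  rw [inst_eq_bind, inst_eq_bind, bind_bind, bind_bind]
  congr 1
  funext n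
  cases n with
  | zero => rfl
  | succ n =>
    simp only [liftSub, bind_of_rename]
    exact (bind_var (σ n)).symm

theorem rename_inst_eq_subst (t : Tm) (x : ℕ) (v : Tm) :
    (t.rename (fun y => if y = x then 0 else y + 1)).inst v = t.subst x v := by
  rw [inst_eq_bind, bind_of_rename]
  unfold subst
  congr 1
  funext n
  split <;> rfl

end Tm

namespace ECtx

/-- Simultaneous substitution of values in an evaluation context. -/
def bind (σ : ℕ → Tm) (hσ : ∀ n, (σ n).IsValue) : ECtx → ECtx
  | hole => hole
  | appR v hv F => appR (v.bind σ) (hv.bind hσ) (F.bind σ hσ)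
  | appL F t => appL (F.bind σ hσ) (t.bind σ)
  | reset F => reset (F.bind σ hσ)

/-- Substitution of a value for one variable in an evaluation context. -/
def subst (F : ECtx) (x : ℕ) (v : Tm) (hv : v.IsValue) : ECtx :=
  F.bind (Tm.single x v) (Tm.single_isValue hv x)

theorem plug_bind (F : ECtx) (t : Tm) (σ : ℕ → Tm) (hσ : ∀ n, (σ n).IsValue) :
    (F.plug t).bind σ = (F.bind σ hσ).plug (t.bind σ) := by
  induction F <;> simp_all [plug, bind, Tm.bind]

theorem bind_congr {F : ECtx} {σ τ : ℕ → Tm} (hσ : ∀ n, (σ n).IsValue)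
    (hτ : ∀ n, (τ n).IsValue) (h : ∀ n ∈ F.fv, σ n = τ n) : F.bind σ hσ = F.bind τ hτ := by
  induction F with
  | hole => rfl
  | appR v hv F ih =>
    simp only [bind, Tm.bind_congr fun n hn => h n (Or.inl hn), ih fun n hn => h n (Or.inr hn)]
  | appL F t ih =>
    simp only [bind, Tm.bind_congr fun n hn => h n (Or.inr hn), ih fun n hn => h n (Or.inl hn)]
  | reset F ih => simp only [bind, ih h]

theorem bind_var (F : ECtx) : F.bind Tm.var (fun _ => trivial) = F := by
  induction F <;> simp_all [bind, Tm.bind_var]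

theorem subst_of_notMem {F : ECtx} {x : ℕ} (h : x ∉ F.fv) (v : Tm) (hv : v.IsValue) :
    F.subst x v hv = F := by
  conv_rhs => rw [← bind_var F]
  refine bind_congr _ _ fun n hn => ?_
  have : n ≠ x := fun e => h (e ▸ hn)
  simp [Tm.single, this]

theorem plug_subst (F : ECtx) (t : Tm) (x : ℕ) (v : Tm) (hv : v.IsValue) :
    (F.plug t).subst x v = (F.subst x v hv).plug (t.subst x v) :=
  plug_bind F t _ _

/-- `F[x]{v/x} = F[v]` when `x` is not free in `F`. -/
theorem plug_var_subst {F : ECtx} {x : ℕ} (h : x ∉ F.fv) {v : Tm} (hv : v.IsValue) :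
    (F.plug (.var x)).subst x v = F.plug v := by
  rw [plug_subst _ _ _ _ hv, subst_of_notMem h, Tm.subst_var_self]

theorem bind_of_rename (F : ECtx) (ρ : ℕ → ℕ) (σ : ℕ → Tm) (hσ : ∀ n, (σ n).IsValue) :
    (F.rename ρ).bind σ hσ = F.bind (fun n => σ (ρ n)) (fun n => hσ (ρ n)) := by
  induction F <;> simp_all [bind, rename, Tm.bind_of_rename]

theorem rename_of_bind (F : ECtx) (ρ : ℕ → ℕ) (σ : ℕ → Tm) (hσ : ∀ n, (σ n).IsValue) :
    (F.bind σ hσ).rename ρ = F.bind (fun n => (σ n).rename ρ) (fun n => (hσ n).rename ρ) := by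
  induction F <;> simp_all [bind, rename, Tm.rename_of_bind]

theorem reify_bind (E : ECtx) (σ : ℕ → Tm) (hσ : ∀ n, (σ n).IsValue) :
    E.reify.bind σ = (E.bind σ hσ).reify := by
  simp only [reify, Tm.bind, plug_bind _ _ _ (Tm.liftSub_isValue hσ), bind_of_rename,
    rename_of_bind]
  rfl

theorem fv_finite (F : ECtx) : F.fv.Finite := by
  induction F with
  | hole => exact Set.finite_empty
  | appR v hv F ih => exact v.fv_finite.union ih
  | appL F t ih => exact ih.union t.fv_finite
  | reset F ih => exact ih

@[simp] theorem plug_comp (F G : ECtx) (t : Tm) : (F.comp G).plug t = F.plug (G.plug t) := by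
  induction F <;> simp_all [comp, plug]

theorem comp_assoc (F G H : ECtx) : (F.comp G).comp H = F.comp (G.comp H) := by
  induction F <;> simp_all [comp]

@[simp] theorem comp_hole (F : ECtx) : F.comp .hole = F := by
  induction F <;> simp_all [comp]

theorem Pure.comp {E G : ECtx} (hE : E.Pure) (hG : G.Pure) : (E.comp G).Pure := by
  induction E <;> simp_all [ECtx.comp, Pure]

theorem Pure.bind {E : ECtx} (hE : E.Pure) (σ : ℕ → Tm) (hσ : ∀ n, (σ n).IsValue) :
    (E.bind σ hσ).Pure := by
  induction E <;> simp_all [ECtx.bind, Pure]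

theorem comp_bind (F G : ECtx) (σ : ℕ → Tm) (hσ : ∀ n, (σ n).IsValue) :
    (F.comp G).bind σ hσ = (F.bind σ hσ).comp (G.bind σ hσ) := by
  induction F <;> simp_all [comp, bind]

theorem not_pure_comp_reset (F E : ECtx) : ¬ (F.comp (.reset E)).Pure := by
  induction F <;> simp_all [comp, Pure]

theorem comp_reset_inj {F F' E E' : ECtx} (hE : E.Pure) (hE' : E'.Pure)
    (h : F.comp (.reset E) = F'.comp (.reset E')) : F = F' ∧ E = E' := by
  induction F generalizing F' with
  | hole =>
    cases F' with
    | reset F' =>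
      simp only [comp, ECtx.reset.injEq] at h
      exact (not_pure_comp_reset F' E' (h ▸ hE)).elim
    | _ => simp_all [comp]
  | reset F ih =>
    cases F' with
    | hole =>
      simp only [comp, ECtx.reset.injEq] at h
      exact (not_pure_comp_reset F E (h ▸ hE')).elim
    | reset F' =>
      simp only [comp, ECtx.reset.injEq] at h
      exact ⟨congrArg _ (ih h).1, (ih h).2⟩
    | _ => simp_all [comp]
  | appR v hv F ih =>
    cases F' with
    | appR v' hv' F' =>
      simp only [comp, ECtx.appR.injEq] at h
      obtain ⟨rfl, h⟩ := h
      obtain ⟨rfl, h2⟩ := ih h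
      exact ⟨rfl, h2⟩
    | _ => simp_all [comp]
  | appL F t ih =>
    cases F' with
    | appL F' t' =>
      simp only [comp, ECtx.appL.injEq] at h
      obtain ⟨h, rfl⟩ := h
      obtain ⟨rfl, h2⟩ := ih h
      exact ⟨rfl, h2⟩
    | _ => simp_all [comp]

/-- An evaluation context either is pure or has an innermost `reset`. -/
theorem pure_or_reset (F : ECtx) : F.Pure ∨ ∃ G E : ECtx, E.Pure ∧ F = G.comp (.reset E) := by
  induction F with
  | hole => exact Or.inl trivial
  | appR v hv F ih =>
    rcases ih with h | ⟨G, E, hE, rfl⟩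
    · exact Or.inl h
    · exact Or.inr ⟨.appR v hv G, E, hE, rfl⟩
  | appL F t ih =>
    rcases ih with h | ⟨G, E, hE, rfl⟩
    · exact Or.inl h
    · exact Or.inr ⟨.appL G t, E, hE, rfl⟩
  | reset F ih =>
    rcases ih with h | ⟨G, E, hE, rfl⟩
    · exact Or.inr ⟨.hole, F, h, rfl⟩
    · exact Or.inr ⟨.reset G, E, hE, rfl⟩

theorem plug_not_isValue (F : ECtx) {t : Tm} (ht : ¬ t.IsValue) : ¬ (F.plug t).IsValue := by
  cases F <;> simp_all [plug, Tm.IsValue]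

end ECtx

/-! ### Unique decomposition and normal forms -/

/-- The terms at which evaluation acts or gets stuck: applications of values to values, and
values under a `reset`. -/
inductive Active : Tm → Prop
  | app {v w : Tm} : v.IsValue → w.IsValue → Active (.app v w)
  | reset {v : Tm} : v.IsValue → Active (.reset v)

theorem Active.not_isValue {r : Tm} (h : Active r) : ¬ r.IsValue := by
  cases h <;> exact id

theorem Active.var_app (x : ℕ) {v : Tm} (hv : v.IsValue) : Active (.app (.var x) v) :=
  .app (v := .var x) trivial hv

theorem Active.shift_app {v : Tm} (hv : v.IsValue) : Active (.app .shift v) :=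
  .app (v := .shift) trivial hv

/-- Unique decomposition. -/
theorem Active.plug_inj {F F' : ECtx} {r r' : Tm} (hr : Active r) (hr' : Active r')
    (h : F.plug r = F'.plug r') : F = F' ∧ r = r' := by
  have key : ∀ {G : ECtx} {q : Tm}, Active q → ¬ (G.plug q).IsValue :=
    fun hq => ECtx.plug_not_isValue _ hq.not_isValue
  induction F generalizing F' with
  | hole =>
    cases F' with
    | hole => exact ⟨rfl, h⟩
    | appR v hv F' =>
      simp only [ECtx.plug] at h
      subst h
      cases hr with
      | app h1 h2 => exact (key hr' h2).elim
    | appL F' t =>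
      simp only [ECtx.plug] at h
      subst h
      cases hr with
      | app h1 h2 => exact (key hr' h1).elim
    | reset F' =>
      simp only [ECtx.plug] at h
      subst h
      cases hr with
      | reset h1 => exact (key hr' h1).elim
  | appR v hv F ih =>
    cases F' with
    | hole =>
      simp only [ECtx.plug] at h
      subst h
      cases hr' with
      | app h1 h2 => exact (key hr h2).elim
    | appR v' hv' F' =>
      simp only [ECtx.plug, Tm.app.injEq] at h
      obtain ⟨rfl, h⟩ := h
      obtain ⟨rfl, rfl⟩ := ih h
      exact ⟨rfl, rfl⟩
    | appL F' t =>
      simp only [ECtx.plug, Tm.app.injEq] at h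
      exact (key hr' (h.1 ▸ hv)).elim
    | reset F' => simp [ECtx.plug] at h
  | appL F t ih =>
    cases F' with
    | hole =>
      simp only [ECtx.plug] at h
      subst h
      cases hr' with
      | app h1 h2 => exact (key hr h1).elim
    | appR v' hv' F' =>
      simp only [ECtx.plug, Tm.app.injEq] at h
      exact (key hr (h.1 ▸ hv')).elim
    | appL F' t' =>
      simp only [ECtx.plug, Tm.app.injEq] at h
      obtain ⟨h, rfl⟩ := h
      obtain ⟨rfl, rfl⟩ := ih h
      exact ⟨rfl, rfl⟩
    | reset F' => simp [ECtx.plug] at h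
  | reset F ih =>
    cases F' with
    | hole =>
      simp only [ECtx.plug] at h
      subst h
      cases hr' with
      | reset h1 => exact (key hr h1).elim
    | reset F' =>
      simp only [ECtx.plug, Tm.reset.injEq] at h
      obtain ⟨rfl, rfl⟩ := ih h
      exact ⟨rfl, rfl⟩
    | _ => simp [ECtx.plug] at h

/-- Reduction, indexed by the decomposition of the source into an evaluation context and an
active term. -/
inductive ActiveStep : ECtx → Tm → Tm → Prop
  | beta (F : ECtx) (t v : Tm) : v.IsValue → ActiveStep F (.app (.lam t) v) (F.plug (t.inst v))
  | capture (F E : ECtx) (v : Tm) : E.Pure → v.IsValue →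
      ActiveStep (F.comp (.reset E)) (.app .shift v) (F.plug (.reset (.app v E.reify)))
  | reset (F : ECtx) (v : Tm) : v.IsValue → ActiveStep F (.reset v) (F.plug v)

theorem ActiveStep.active {F : ECtx} {r t : Tm} (h : ActiveStep F r t) : Active r := by
  cases h with
  | beta _ _ _ hv => exact .app trivial hv
  | capture _ _ _ _ hv => exact .app trivial hv
  | reset _ _ hv => exact .reset hv

theorem step_iff {t t' : Tm} : Step t t' ↔ ∃ F r, t = F.plug r ∧ ActiveStep F r t' := by
  constructor
  · rintro (⟨F, t, v, hv⟩ | ⟨F, E, v, hE, hv⟩ | ⟨F, v, hv⟩)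
    · exact ⟨F, _, rfl, .beta F t v hv⟩
    · exact ⟨_, _, (F.plug_comp (.reset E) _).symm, .capture F E v hE hv⟩
    · exact ⟨F, _, rfl, .reset F v hv⟩
  · rintro ⟨F, r, rfl, h⟩
    cases h with
    | beta _ t v hv => exact .beta F t v hv
    | capture F E v hE hv =>
      rw [ECtx.plug_comp]
      exact .capture F E v hE hv
    | reset _ v hv => exact .reset F v hv

theorem step_plug_iff {F : ECtx} {r t : Tm} (hr : Active r) :
    Step (F.plug r) t ↔ ActiveStep F r t := by
  rw [step_iff]
  constructor
  · rintro ⟨F', r', h, h'⟩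
    obtain ⟨rfl, rfl⟩ := hr.plug_inj h'.active h
    exact h'
  · exact fun h => ⟨F, r, rfl, h⟩

theorem ActiveStep.deterministic {F : ECtx} {r t t' : Tm} (h : ActiveStep F r t)
    (h' : ActiveStep F r t') : t = t' := by
  cases h with
  | beta _ t v hv => cases h'; rfl
  | capture F E v hE hv =>
    generalize hG : F.comp (.reset E) = G at h'
    generalize hs : Tm.app .shift v = s at h'
    cases h' with
    | beta => cases hs
    | reset => cases hs
    | capture F' E' v' hE' =>
      obtain ⟨rfl, rfl⟩ := ECtx.comp_reset_inj hE hE' hG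
      cases hs
      rfl
  | reset _ v hv => cases h'; rfl

theorem Step.deterministic {t u u' : Tm} (h : Step t u) (h' : Step t u') : u = u' := by
  obtain ⟨F, r, rfl, hs⟩ := step_iff.1 h
  exact hs.deterministic ((step_plug_iff hs.active).1 h')

theorem Step.not_isValue {t u : Tm} (h : Step t u) : ¬ t.IsValue := by
  obtain ⟨F, r, rfl, hs⟩ := step_iff.1 h
  exact F.plug_not_isValue hs.active.not_isValue

theorem not_step_of_isValue {v : Tm} (hv : v.IsValue) (u : Tm) : ¬ Step v u :=
  fun h => h.not_isValue hv

theorem not_step_open (F : ECtx) (x : ℕ) {v : Tm} (hv : v.IsValue) (u : Tm) :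
    ¬ Step (F.plug (.app (.var x) v)) u := by
  rw [step_plug_iff (.var_app x hv)]
  intro h
  cases h

theorem not_step_ctrl {E : ECtx} (hE : E.Pure) {v : Tm} (hv : v.IsValue) (u : Tm) :
    ¬ Step (E.plug (.app .shift v)) u := by
  rw [step_plug_iff (.shift_app hv)]
  intro h
  cases h with
  | capture F E => exact ECtx.not_pure_comp_reset _ _ hE

/-- The cases for evaluation: a term reduces, or it is a value, an open stuck term or a
control-stuck term. -/
theorem step_or_normal (t : Tm) :
    (∃ t', Step t t') ∨ t.IsValue ∨
      (∃ F x v, Tm.IsValue v ∧ t = ECtx.plug F (.app (.var x) v)) ∨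
      ∃ E v, ECtx.Pure E ∧ Tm.IsValue v ∧ t = E.plug (.app .shift v) := by
  have main : t.IsValue ∨ ∃ F r, Active r ∧ t = ECtx.plug F r := by
    induction t with
    | var | lam | shift => exact Or.inl trivial
    | app t s iht ihs =>
      right
      rcases iht with ht | ⟨F, r, hr, rfl⟩
      · rcases ihs with hs | ⟨F, r, hr, rfl⟩
        · exact ⟨.hole, _, .app ht hs, rfl⟩
        · exact ⟨.appR t ht F, r, hr, rfl⟩
      · exact ⟨.appL F s, r, hr, rfl⟩
    | reset t ih =>
      right
      rcases ih with ht | ⟨F, r, hr, rfl⟩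
      · exact ⟨.hole, _, .reset ht, rfl⟩
      · exact ⟨.reset F, r, hr, rfl⟩
  rcases main with h | ⟨F, r, hr, rfl⟩
  · exact Or.inr (Or.inl h)
  cases hr with
  | @app v w hv hw =>
    cases v with
    | var x => exact Or.inr (Or.inr (Or.inl ⟨F, x, w, hw, rfl⟩))
    | lam t => exact Or.inl ⟨_, .beta F t w hw⟩
    | shift =>
      rcases F.pure_or_reset with hF | ⟨G, E, hE, rfl⟩
      · exact Or.inr (Or.inr (Or.inr ⟨F, w, hF, hw, rfl⟩))
      · rw [ECtx.plug_comp]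
        exact Or.inl ⟨_, .capture G E w hE hw⟩
    | app => exact hv.elim
    | reset => exact hv.elim
  | reset hv => exact Or.inl ⟨_, .reset F _ hv⟩

theorem open_plug_inj {F F' : ECtx} {x x' : ℕ} {v v' : Tm} (hv : v.IsValue) (hv' : v'.IsValue)
    (h : F.plug (.app (.var x) v) = F'.plug (.app (.var x') v')) :
    F = F' ∧ x = x' ∧ v = v' := by
  obtain ⟨rfl, e⟩ := Active.plug_inj (.var_app x hv) (.var_app x' hv') h
  cases e
  exact ⟨rfl, rfl, rfl⟩

theorem ctrl_plug_inj {F F' : ECtx} {v v' : Tm} (hv : v.IsValue) (hv' : v'.IsValue)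
    (h : F.plug (.app .shift v) = F'.plug (.app .shift v')) : F = F' ∧ v = v' := by
  obtain ⟨rfl, e⟩ := Active.plug_inj (.shift_app hv) (.shift_app hv') h
  cases e
  exact ⟨rfl, rfl⟩

theorem open_plug_ne_ctrl {F F' : ECtx} {x : ℕ} {v v' : Tm} (hv : v.IsValue) (hv' : v'.IsValue) :
    F.plug (.app (.var x) v) ≠ F'.plug (.app .shift v') := by
  intro h
  cases (Active.plug_inj (.var_app x hv) (.shift_app hv') h).2

/-! ### Compatibility of reduction with contexts and substitutions -/

theorem Step.plug (F : ECtx) {t t' : Tm} (h : Step t t') : Step (F.plug t) (F.plug t') := by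
  cases h with
  | beta G t v hv => simpa using Step.beta (F.comp G) t v hv
  | capture G E v hE hv => simpa using Step.capture (F.comp G) E v hE hv
  | reset G v hv => simpa using Step.reset (F.comp G) v hv

theorem Steps.plug (F : ECtx) {t t' : Tm} (h : Steps t t') : Steps (F.plug t) (F.plug t') :=
  Relation.ReflTransGen.lift F.plug (fun _ _ => Step.plug F) _ _ h

theorem Step.subst {t t' : Tm} (h : Step t t') (x : ℕ) {v : Tm} (hv : v.IsValue) :
    Step (t.subst x v) (t'.subst x v) := by
  have hσ := Tm.single_isValue hv x
  simp only [Tm.subst_eq_bind]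
  cases h with
  | beta F t v hv =>
    rw [ECtx.plug_bind _ _ _ hσ, ECtx.plug_bind _ _ _ hσ, Tm.bind_inst]
    exact Step.beta _ _ _ (hv.bind hσ)
  | capture F E v hE hv =>
    rw [ECtx.plug_bind _ _ _ hσ, ECtx.plug_bind _ _ _ hσ]
    simp only [Tm.bind]
    rw [ECtx.plug_bind _ _ _ hσ, ECtx.reify_bind _ _ hσ]
    exact Step.capture _ _ _ (hE.bind _ hσ) (hv.bind hσ)
  | reset F v hv =>
    rw [ECtx.plug_bind _ _ _ hσ, ECtx.plug_bind _ _ _ hσ]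
    exact Step.reset _ _ (hv.bind hσ)

theorem Steps.subst {t t' : Tm} (h : Steps t t') (x : ℕ) {v : Tm} (hv : v.IsValue) :
    Steps (t.subst x v) (t'.subst x v) :=
  Relation.ReflTransGen.lift (fun t => Tm.subst t x v) (fun _ _ h => Step.subst h x hv) _ _ h

theorem step_abs_app (x : ℕ) (t : Tm) {v : Tm} (hv : v.IsValue) :
    Step (.app (t.abs x) v) (t.subst x v) := by
  have h := Step.beta .hole (t.rename (fun y => if y = x then 0 else y + 1)) v hv
  rwa [Tm.rename_inst_eq_subst] at h

theorem step_reify_app (E : ECtx) {v : Tm} (hv : v.IsValue) :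
    Step (.app E.reify v) (.reset (E.plug v)) := by
  have h := Step.beta .hole (.reset ((E.rename Nat.succ).plug (.var 0))) v hv
  have e : (Tm.reset ((E.rename Nat.succ).plug (.var 0))).inst v = .reset (E.plug v) := by
    rw [Tm.inst_eq_bind]
    simp only [Tm.bind]
    rw [ECtx.plug_bind _ _ _ (Tm.head_isValue hv), ECtx.bind_of_rename]
    exact congrArg (fun F => Tm.reset (ECtx.plug F v)) E.bind_var
  rwa [e] at h

theorem Step.isPure {t t' : Tm} (h : Step t t') (ht : t.IsPure) : t'.IsPure := by
  cases h with
  | beta F => cases F <;> trivial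
  | capture F => cases F <;> trivial
  | reset F v hv =>
    cases F with
    | hole => exact hv.isPure
    | reset => trivial
    | _ => exact ht.elim

theorem Steps.isPure {t t' : Tm} (h : Steps t t') (ht : t.IsPure) : t'.IsPure := by
  induction h with
  | refl => exact ht
  | tail _ h ih => exact h.isPure ih

/-! ### Continuous functions and closures -/

theorem IsContinuous.mono {f : RelFun} (hf : IsContinuous f) {R S : TmRel} (h : R ≤ S) :
    f R ≤ f S := by
  intro t s hts
  obtain ⟨R₀, hR₀, hfin, h₀⟩ := (hf R t s).1 hts
  exact (hf S t s).2 ⟨R₀, hR₀.trans h, hfin, h₀⟩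

/-- A finite part of the union of an increasing sequence lies in one of its terms. -/
theorem exists_le_of_finite {u : ℕ → TmRel} (hu : Monotone u) {R₀ : TmRel}
    (hfin : {p : Tm × Tm | R₀ p.1 p.2}.Finite) (h : R₀ ≤ fun t s => ∃ n, u n t s) :
    ∃ n, R₀ ≤ u n := by
  have hall : ∀ p : Tm × Tm, ∃ n, R₀ p.1 p.2 → u n p.1 p.2 := by
    intro p
    by_cases hp : R₀ p.1 p.2
    · obtain ⟨n, hn⟩ := h _ _ hp
      exact ⟨n, fun _ => hn⟩
    · exact ⟨0, fun h => (hp h).elim⟩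
  choose n hn using hall
  obtain ⟨N, hN⟩ := (hfin.image n).bddAbove
  refine ⟨N, fun t s hts => ?_⟩
  exact hu (hN ⟨(t, s), hts, rfl⟩) _ _ (hn (t, s) hts)

section

variable {𝓕 : Set RelFun}

theorem le_hat (f : RelFun) (R : TmRel) : R ≤ hat f R := le_sup_right

theorem monotone_iterate_hat (f : RelFun) (R : TmRel) : Monotone fun n => (hat f)^[n] R := by
  refine monotone_nat_of_le_succ fun n => ?_
  simp only [Function.iterate_succ', Function.comp]
  exact le_hat _ _

theorem le_closure (R : TmRel) : R ≤ closure 𝓕 R := fun _ _ h => ⟨0, h⟩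

/-- The closure of a relation is closed under the generating functions. -/
theorem apply_closure_le (hc : ∀ f ∈ 𝓕, IsContinuous f) {f : RelFun} (hf : f ∈ 𝓕) (R : TmRel) :
    f (closure 𝓕 R) ≤ closure 𝓕 R := by
  intro t s h
  obtain ⟨R₀, hR₀, hfin, h₀⟩ := (hc f hf _ t s).1 h
  obtain ⟨n, hn⟩ := exists_le_of_finite (monotone_iterate_hat (unionFun 𝓕) R) hfin hR₀
  refine ⟨n + 1, ?_⟩
  rw [Function.iterate_succ', Function.comp]
  exact Or.inl ⟨f, hf, (hc f hf).mono hn _ _ h₀⟩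

/-- The closure of `R` is below every relation that contains `R` and is closed under the
generating functions. -/
theorem closure_le (hc : ∀ f ∈ 𝓕, IsContinuous f) {R X : TmRel} (hR : R ≤ X)
    (hX : ∀ f ∈ 𝓕, f X ≤ X) : closure 𝓕 R ≤ X := by
  rintro t s ⟨n, hn⟩
  induction n generalizing t s with
  | zero => exact hR _ _ hn
  | succ n ih =>
    rw [Function.iterate_succ', Function.comp] at hn
    rcases hn with ⟨f, hf, h⟩ | h
    · exact hX f hf _ _ ((hc f hf).mono ih _ _ h)
    · exact ih _ _ h

theorem closure_mono (hc : ∀ f ∈ 𝓕, IsContinuous f) {R S : TmRel} (h : R ≤ S) :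
    closure 𝓕 R ≤ closure 𝓕 S :=
  closure_le hc (h.trans (le_closure S)) fun _ hf => apply_closure_le hc hf S

theorem Generated.mono (hc : ∀ f ∈ 𝓕, IsContinuous f) {f : RelFun} (hf : Generated 𝓕 f)
    {R S : TmRel} (h : R ≤ S) : f R ≤ f S := by
  induction hf generalizing R S with
  | mem f hf => exact (hc f hf).mono h
  | id => exact h
  | union f g _ _ ihf ihg => exact sup_le_sup (ihf h) (ihg h)
  | comp f g _ _ ihf ihg => exact ihf (ihg h)
  | omega f _ ih =>
    rintro t s ⟨n, hn⟩
    exact ⟨n, Monotone.iterate (f := f) (fun _ _ h => ih h) n h _ _ hn⟩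

theorem Generated.apply_le (hc : ∀ f ∈ 𝓕, IsContinuous f) {f : RelFun} (hf : Generated 𝓕 f)
    {X : TmRel} (hX : ∀ g ∈ 𝓕, g X ≤ X) : f X ≤ X := by
  induction hf with
  | mem f hf => exact hX f hf
  | id => exact le_rfl
  | union f g _ _ ihf ihg => exact sup_le ihf ihg
  | comp f g hf _ ihf ihg => exact (hf.mono hc ihg).trans ihf
  | omega f hf ih =>
    rintro t s ⟨n, hn⟩
    induction n generalizing t s with
    | zero => exact hn
    | succ n ihn =>
      rw [Function.iterate_succ', Function.comp] at hn
      exact ih _ _ (hf.mono hc ihn _ _ hn)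

theorem Generated.le_closure (hc : ∀ f ∈ 𝓕, IsContinuous f) {f : RelFun} (hf : Generated 𝓕 f)
    (R : TmRel) : f R ≤ closure 𝓕 R :=
  (hf.mono hc (ShiftReset.le_closure R)).trans
    (hf.apply_le hc fun _ hg => apply_closure_le hc hg R)

end

/-! ### Diacritical progress -/

/-- The clauses of progress for one pair of terms. -/
def HalfClauses (S T : TmRel) (t s : Tm) : Prop :=
  (∀ t', Step t t' → ∃ s', Steps s s' ∧ T t' s') ∧
  (t.IsValue → ∃ w, w.IsValue ∧ EvalsTo s w ∧ TestVal S t w) ∧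
  (∀ F x v, v.IsValue → t = ECtx.plug F (.app (.var x) v) →
    ∃ F' w, w.IsValue ∧ EvalsTo s (ECtx.plug F' (.app (.var x) w)) ∧
      TestOpen T (F.plug (.app (.var x) v)) (F'.plug (.app (.var x) w))) ∧
  (∀ E v, ECtx.Pure E → v.IsValue → t = E.plug (.app .shift v) →
    ∃ E' w, ECtx.Pure E' ∧ w.IsValue ∧ EvalsTo s (E'.plug (.app .shift w)) ∧
      TestCtrl T (E.plug (.app .shift v)) (E'.plug (.app .shift w)))

theorem TestVal.mono {R S : TmRel} (h : R ≤ S) {v w : Tm} (hvw : TestVal R v w) :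
    TestVal S v w := by
  obtain ⟨hv, hw, x, hx, hx', hR⟩ := hvw
  exact ⟨hv, hw, x, hx, hx', h _ _ hR⟩

theorem TestCtx.mono {R S : TmRel} (h : R ≤ S) {F F' : ECtx} (hF : TestCtx R F F') :
    TestCtx S F F' := by
  cases hF with
  | pure E E' x hE hE' hx hx' hR => exact .pure _ _ x hE hE' hx hx' (h _ _ hR)
  | reset F F' E E' x hE hE' h1 h2 h3 h4 hR hR' =>
    exact .reset _ _ _ _ x hE hE' h1 h2 h3 h4 (h _ _ hR) (h _ _ hR')

theorem TestOpen.mono {R S : TmRel} (h : R ≤ S) {t s : Tm} (hts : TestOpen R t s) :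
    TestOpen S t s := by
  obtain ⟨F, F', x, v, w, hF, hv⟩ := hts
  exact ⟨F, F', x, v, w, hF.mono h, hv.mono h⟩

theorem TestCtrl.mono {R S : TmRel} (h : R ≤ S) {t s : Tm} (hts : TestCtrl R t s) :
    TestCtrl S t s := by
  obtain ⟨E, E', v, w, x, hE, hE', hv, hw, hF, hx, hx', hR⟩ := hts
  exact ⟨E, E', v, w, x, hE, hE', hv, hw, hF.mono h, hx, hx', h _ _ hR⟩

theorem HalfClauses.mono {S S' T T' : TmRel} (hS : S ≤ S') (hT : T ≤ T') {t s : Tm}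
    (h : HalfClauses S T t s) : HalfClauses S' T' t s := by
  obtain ⟨h1, h2, h3, h4⟩ := h
  refine ⟨fun t' ht => ?_, fun ht => ?_, fun F x v hv e => ?_, fun E v hE hv e => ?_⟩
  · obtain ⟨s', hs, h⟩ := h1 t' ht
    exact ⟨s', hs, hT _ _ h⟩
  · obtain ⟨w, hw, hs, h⟩ := h2 ht
    exact ⟨w, hw, hs, h.mono hS⟩
  · obtain ⟨F', w, hw, hs, h⟩ := h3 F x v hv e
    exact ⟨F', w, hw, hs, h.mono hT⟩
  · obtain ⟨E', w, hE', hw, hs, h⟩ := h4 E v hE hv e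
    exact ⟨E', w, hE', hw, hs, h.mono hT⟩

theorem EvalsTo.expand {s s₀ u : Tm} (h : Steps s s₀) (hs : EvalsTo s₀ u) : EvalsTo s u :=
  ⟨h.trans hs.1, hs.2⟩

theorem HalfClauses.expand_right {S T : TmRel} {t s s₀ : Tm} (hs : Steps s s₀)
    (h : HalfClauses S T t s₀) : HalfClauses S T t s := by
  obtain ⟨h1, h2, h3, h4⟩ := h
  refine ⟨fun t' ht => ?_, fun ht => ?_, fun F x v hv e => ?_, fun E v hE hv e => ?_⟩
  · obtain ⟨s', hs', h⟩ := h1 t' ht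
    exact ⟨s', hs.trans hs', h⟩
  · obtain ⟨w, hw, hs', h⟩ := h2 ht
    exact ⟨w, hw, hs'.expand hs, h⟩
  · obtain ⟨F', w, hw, hs', h⟩ := h3 F x v hv e
    exact ⟨F', w, hw, hs'.expand hs, h⟩
  · obtain ⟨E', w, hE', hw, hs', h⟩ := h4 E v hE hv e
    exact ⟨E', w, hE', hw, hs'.expand hs, h⟩

theorem HalfClauses.of_step {S T : TmRel} {t t' s s' : Tm} (ht : Step t t') (hs : Steps s s')
    (h : T t' s') : HalfClauses S T t s := by
  refine ⟨fun u hu => ?_, fun hv => ?_, fun F x v hv e => ?_, fun E v hE hv e => ?_⟩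
  · obtain rfl := ht.deterministic hu
    exact ⟨s', hs, h⟩
  · exact (ht.not_isValue hv).elim
  · subst e
    exact (not_step_open F x hv _ ht).elim
  · subst e
    exact (not_step_ctrl hE hv _ ht).elim

theorem HalfClauses.of_value {S T : TmRel} {t s w : Tm} (hs : Steps s w) (h : TestVal S t w) :
    HalfClauses S T t s := by
  have ht := h.1
  refine ⟨fun u hu => ?_, fun _ => ?_, fun F x v hv e => ?_, fun E v hE hv e => ?_⟩
  · exact (hu.not_isValue ht).elim
  · exact ⟨w, h.2.1, ⟨hs, not_step_of_isValue h.2.1⟩, h⟩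
  · subst e
    exact (F.plug_not_isValue id ht).elim
  · subst e
    exact (E.plug_not_isValue id ht).elim

theorem HalfClauses.of_open {S T : TmRel} {F F' : ECtx} {x : ℕ} {v w s : Tm}
    (hs : Steps s (F'.plug (.app (.var x) w))) (hF : TestCtx T F F') (hv : TestVal T v w) :
    HalfClauses S T (F.plug (.app (.var x) v)) s := by
  refine ⟨fun u hu => ?_, fun h => ?_, fun G y u hu e => ?_, fun E u hE hu e => ?_⟩
  · exact (not_step_open F x hv.1 _ hu).elim
  · exact (F.plug_not_isValue id h).elim
  · obtain ⟨rfl, rfl, rfl⟩ := open_plug_inj hv.1 hu e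
    exact ⟨F', w, hv.2.1, ⟨hs, not_step_open _ _ hv.2.1⟩, ⟨F, F', x, v, w, hF, hv⟩⟩
  · exact (open_plug_ne_ctrl hv.1 hu e).elim

theorem HalfClauses.of_ctrl {S T : TmRel} {E E' : ECtx} {v w s : Tm}
    (hs : Steps s (E'.plug (.app .shift w)))
    (h : TestCtrl T (E.plug (.app .shift v)) (E'.plug (.app .shift w)))
    (hE : E.Pure) (hE' : E'.Pure) (hv : v.IsValue) (hw : w.IsValue) :
    HalfClauses S T (E.plug (.app .shift v)) s := by
  refine ⟨fun u hu => ?_, fun h => ?_, fun G y u hu e => ?_, fun G u hG hu e => ?_⟩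
  · exact (not_step_ctrl hE hv _ hu).elim
  · exact (E.plug_not_isValue id h).elim
  · exact (open_plug_ne_ctrl hu hv e.symm).elim
  · obtain ⟨rfl, rfl⟩ := ctrl_plug_inj hv hu e
    exact ⟨E', w, hE', hw, ⟨hs, not_step_ctrl hE' hw⟩, h⟩

theorem HalfClauses.of_isValue {S T : TmRel} {t s : Tm} (h : HalfClauses S T t s)
    (ht : t.IsValue) : ∃ w, Steps s w ∧ TestVal S t w := by
  obtain ⟨w, _, hs, h⟩ := h.2.1 ht
  exact ⟨w, hs.1, h⟩

theorem HalfClauses.of_open_left {S T : TmRel} {F : ECtx} {x : ℕ} {v s : Tm}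
    (h : HalfClauses S T (F.plug (.app (.var x) v)) s) (hv : v.IsValue) :
    ∃ F' w, Steps s (ECtx.plug F' (.app (.var x) w)) ∧ TestCtx T F F' ∧ TestVal T v w := by
  obtain ⟨F', w, hw, hs, h⟩ := h.2.2.1 F x v hv rfl
  refine ⟨F', w, hs.1, ?_⟩
  generalize e : F.plug (.app (.var x) v) = t at h
  generalize e' : F'.plug (.app (.var x) w) = t' at h
  obtain ⟨G, G', y, u, u', hG, hu⟩ := h
  obtain ⟨rfl, rfl, rfl⟩ := open_plug_inj hv hu.1 e
  obtain ⟨rfl, -, rfl⟩ := open_plug_inj hw hu.2.1 e'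
  exact ⟨hG, hu⟩

theorem HalfClauses.of_ctrl_left {S T : TmRel} {E : ECtx} {v s : Tm}
    (h : HalfClauses S T (E.plug (.app .shift v)) s) (hE : E.Pure) (hv : v.IsValue) :
    ∃ E' w x, ECtx.Pure E' ∧ w.IsValue ∧ Steps s (E'.plug (.app .shift w)) ∧ TestCtx T E E' ∧
      x ∉ v.fv ∧ x ∉ w.fv ∧ T (.reset (.app v (.var x))) (.reset (.app w (.var x))) := by
  obtain ⟨E', w, hE', hw, hs, h⟩ := h.2.2.2 E v hE hv rfl
  generalize e : E.plug (.app .shift v) = t at h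
  generalize e' : E'.plug (.app .shift w) = t' at h
  obtain ⟨G, G', u, u', x, -, -, hu, hu', hG, hx, hx', hT⟩ := h
  obtain ⟨rfl, rfl⟩ := ctrl_plug_inj hv hu e
  obtain ⟨rfl, rfl⟩ := ctrl_plug_inj hw hu' e'
  exact ⟨E', w, x, hE', hw, e' ▸ hs.1, hG, hx, hx', hT⟩

/-- The four possible shapes of a pair of terms that satisfies the clauses of progress. -/
theorem HalfClauses.cases {S T : TmRel} {t s : Tm} (h : HalfClauses S T t s) :
    (∃ t' s', Step t t' ∧ Steps s s' ∧ T t' s') ∨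
    (∃ w, Steps s w ∧ TestVal S t w) ∨
    (∃ F F' x v w, t = ECtx.plug F (.app (.var x) v) ∧ Steps s (F'.plug (.app (.var x) w)) ∧
      TestCtx T F F' ∧ TestVal T v w) ∨
    (∃ E E' v w x, ECtx.Pure E ∧ ECtx.Pure E' ∧ v.IsValue ∧ w.IsValue ∧
      t = E.plug (.app .shift v) ∧ Steps s (E'.plug (.app .shift w)) ∧ TestCtx T E E' ∧
      x ∉ v.fv ∧ x ∉ w.fv ∧ T (.reset (.app v (.var x))) (.reset (.app w (.var x)))) := by
  rcases step_or_normal t with ⟨t', ht⟩ | ht | ⟨F, x, v, hv, rfl⟩ | ⟨E, v, hE, hv, rfl⟩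
  · obtain ⟨s', hs, h⟩ := h.1 t' ht
    exact Or.inl ⟨t', s', ht, hs, h⟩
  · exact Or.inr (Or.inl (h.of_isValue ht))
  · obtain ⟨F', w, h⟩ := h.of_open_left hv
    exact Or.inr (Or.inr (Or.inl ⟨F, F', x, v, w, rfl, h⟩))
  · obtain ⟨E', w, x, hE', hw, h⟩ := h.of_ctrl_left hE hv
    exact Or.inr (Or.inr (Or.inr ⟨E, E', v, w, x, hE, hE', hv, hw, rfl, h⟩))

theorem HalfProgress.clauses {R S T : TmRel} (h : HalfProgress R S T) {t s : Tm} (hts : R t s) :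
    HalfClauses S T t s := h t s hts

theorem HalfProgress.intro {R S T : TmRel} (h : ∀ t s, R t s → HalfClauses S T t s) :
    HalfProgress R S T := h

theorem Progress.mono {R S T S' T' : TmRel} (h : Progress R S T) (hS : S ≤ S') (hT : T ≤ T')
    (hST : S' ≤ T') : Progress R S' T' := by
  obtain ⟨h1, h2, h3, h4⟩ := h
  exact ⟨h1.trans hS, hST, fun t s h => (h3.clauses h).mono hS hT,
    fun t s h => (h4.clauses h).mono (fun _ _ h => hS _ _ h) (fun _ _ h => hT _ _ h)⟩

theorem Progress.swap {R S T : TmRel} (h : Progress R S T) :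
    Progress (Function.swap R) (Function.swap S) (Function.swap T) :=
  ⟨fun _ _ h' => h.1 _ _ h', fun _ _ h' => h.2.1 _ _ h', h.2.2.2, h.2.2.1⟩

theorem Progress.of_pointwise {R S T : TmRel} (hST : S ≤ T)
    (h : ∀ t s, R t s → ∃ R', R' t s ∧ Progress R' S T) : Progress R S T := by
  refine ⟨fun t s hts => ?_, hST, fun t s hts => ?_, fun t s hts => ?_⟩
  · obtain ⟨R', h', hR'⟩ := h t s hts
    exact hR'.1 _ _ h'
  · obtain ⟨R', h', hR'⟩ := h t s hts
    exact hR'.2.2.1 _ _ h'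
  · obtain ⟨R', h', hR'⟩ := h s t hts
    exact hR'.2.2.2 _ _ h'

theorem isBisimulation_bisim : IsBisimulation Bisim := by
  refine Progress.of_pointwise le_rfl fun t s => ?_
  rintro ⟨R, hR, h⟩
  have hle : R ≤ Bisim := fun t s h => ⟨R, hR, h⟩
  exact ⟨R, h, hR.mono hle hle le_rfl⟩

theorem IsBisimulation.le_bisim {R : TmRel} (hR : IsBisimulation R) : R ≤ Bisim :=
  fun _ _ h => ⟨R, hR, h⟩

/-! ### Soundness of diacritical compatibility -/

section

variable {𝓕 𝓢 : Set RelFun}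

/-- Strong functions can be iterated on the source of a progress. -/
theorem IsStrongPart.progress_closure (hc : ∀ f ∈ 𝓕, IsContinuous f) (hS : IsStrongPart 𝓕 𝓢)
    {R T : TmRel} (hT : ∀ f ∈ 𝓕, f T ≤ T) (h : Progress R (closure 𝓢 R) T) :
    Progress (closure 𝓢 R) (closure 𝓢 R) T := by
  have hcS : ∀ f ∈ 𝓢, IsContinuous f := fun f hf => hc f (hS.1 hf)
  have key : ∀ n, Progress ((hat (unionFun 𝓢))^[n] R) (closure 𝓢 R) T := by
    intro n
    induction n with
    | zero => exact h
    | succ n ih =>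
      rw [Function.iterate_succ', Function.comp]
      refine Progress.of_pointwise h.2.1 fun t s hts => ?_
      rcases hts with ⟨f, hf, hts⟩ | hts
      · exact ⟨_, hts, (hS.2.1 f hf _ _ _ ih).mono
          (closure_le hcS le_rfl fun f hf => apply_closure_le hcS hf R)
          (closure_le hc le_rfl hT) h.2.1⟩
      · exact ⟨_, hts, ih⟩
  refine Progress.of_pointwise h.2.1 fun t s hts => ?_
  obtain ⟨n, hn⟩ := hts
  exact ⟨_, hn, key n⟩

/-- The closure of `R` is reached from the strong closure of `R` by alternating one application
of the functions of `𝓕` and a strong closure.  Each stage progresses with itself as the passive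
relation, since evolution of `𝓕` is only up to the strong closure. -/
theorem IsStrongPart.isBisimulation (hc : ∀ f ∈ 𝓕, IsContinuous f) (hS : IsStrongPart 𝓕 𝓢)
    {R : TmRel} (h : Progress R (closure 𝓢 R) (closure 𝓕 R)) :
    IsBisimulation (closure 𝓕 R) := by
  have hcS : ∀ f ∈ 𝓢, IsContinuous f := fun f hf => hc f (hS.1 hf)
  have hT : ∀ f ∈ 𝓕, f (closure 𝓕 R) ≤ closure 𝓕 R := fun f hf => apply_closure_le hc hf R
  set T := closure 𝓕 R with hTdef
  let next : TmRel → TmRel := fun X => closure 𝓢 (hat (unionFun 𝓕) X)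
  let stage : ℕ → TmRel := fun n => next^[n] (closure 𝓢 R)
  have stage_succ : ∀ n, stage (n + 1) = closure 𝓢 (hat (unionFun 𝓕) (stage n)) := fun n => by
    simp only [stage, next, Function.iterate_succ', Function.comp]
  have closed : ∀ n, closure 𝓢 (stage n) ≤ stage n := by
    intro n
    refine closure_le hcS le_rfl fun f hf => ?_
    cases n with
    | zero => exact apply_closure_le hcS hf R
    | succ n =>
      rw [stage_succ]
      exact apply_closure_le hcS hf _
  have progress : ∀ n, Progress (stage n) (stage n) T := by
    intro n
    induction n with
    | zero => exact hS.progress_closure hc hT h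
    | succ n ih =>
      rw [stage_succ]
      have hle : stage n ≤ T := ih.1.trans ih.2.1
      have hhat : hat (unionFun 𝓕) (stage n) ≤ T := by
        refine sup_le ?_ hle
        rintro t s ⟨f, hf, hts⟩
        exact hT f hf _ _ ((hc f hf).mono hle _ _ hts)
      have hnext : closure 𝓢 (hat (unionFun 𝓕) (stage n)) ≤ T :=
        closure_le hcS hhat fun f hf => hT f (hS.1 hf)
      refine hS.progress_closure hc hT (Progress.of_pointwise hnext fun t s hts => ?_)
      rcases hts with ⟨f, hf, hts⟩ | hts
      · refine ⟨_, hts, (hS.2.2 f hf _ _ ih).mono (closure_mono hcS ?_)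
          (closure_le hc le_rfl hT) hnext⟩
        refine sup_le_sup ?_ (closed n)
        rintro t s ⟨g, hg, h⟩
        exact ⟨g, hg, (hc g hg).mono (closed n) _ _ h⟩
      · exact ⟨_, hts, ih.mono ((le_hat _ _).trans (le_closure _)) le_rfl hnext⟩
  have cover : ∀ n, (hat (unionFun 𝓕))^[n] R ≤ stage n := by
    intro n
    induction n with
    | zero => exact le_closure R
    | succ n ih =>
      rw [stage_succ, Function.iterate_succ', Function.comp]
      refine le_trans (sup_le_sup ?_ ih) (le_closure _)
      rintro t s ⟨f, hf, h⟩
      exact ⟨f, hf, (hc f hf).mono ih _ _ h⟩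
  refine Progress.of_pointwise le_rfl fun t s hts => ?_
  obtain ⟨n, hn⟩ := hts
  exact ⟨_, cover n _ _ hn, (progress n).mono ((progress n).1.trans (progress n).2.1) le_rfl le_rfl⟩

theorem IsStrongPart.isUpTo (hc : ∀ f ∈ 𝓕, IsContinuous f) (hS : IsStrongPart 𝓕 𝓢)
    {f : RelFun} (hf : ∀ R, f R ≤ closure 𝓕 R) : IsUpTo f := by
  intro R h
  have h' : Progress R (closure 𝓢 R) (closure 𝓕 R) :=
    h.mono (le_closure R) (hf R) (closure_le (fun f hf => hc f (hS.1 hf)) (le_closure R)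
      fun g hg => apply_closure_le hc (hS.1 hg) R)
  exact (le_closure R).trans (hS.isBisimulation hc h').le_bisim

theorem IsStrongPart.isStrongUpTo (hc : ∀ f ∈ 𝓕, IsContinuous f) (hS : IsStrongPart 𝓕 𝓢)
    {f : RelFun} (hf : ∀ R, f R ≤ closure 𝓢 R) : IsStrongUpTo f := by
  intro R h
  have hle : closure 𝓢 R ≤ closure 𝓕 R :=
    closure_le (fun f hf => hc f (hS.1 hf)) (le_closure R)
      fun g hg => apply_closure_le hc (hS.1 hg) R
  have h' : Progress R (closure 𝓢 R) (closure 𝓕 R) := h.mono (hf R) ((hf R).trans hle) hle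
  exact (le_closure R).trans (hS.isBisimulation hc h').le_bisim

theorem IsStrongPart.apply_bisim_le (hc : ∀ f ∈ 𝓕, IsContinuous f) (hS : IsStrongPart 𝓕 𝓢)
    {f : RelFun} (hf : f ∈ 𝓕) : f Bisim ≤ Bisim := by
  have hle : closure 𝓢 Bisim ≤ closure 𝓕 Bisim :=
    closure_le (fun f hf => hc f (hS.1 hf)) (le_closure _)
      fun g hg => apply_closure_le hc (hS.1 hg) _
  have h := hS.isBisimulation hc
    (isBisimulation_bisim.mono (le_closure _) (le_closure _) hle)
  exact ((hc f hf).mono (le_closure _)).trans ((apply_closure_le hc hf _).trans h.le_bisim)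

end

/-! ### Continuity and symmetry of the techniques -/

theorem IsContinuous.of_finite_support {f : RelFun} (hmono : ∀ R S : TmRel, R ≤ S → f R ≤ f S)
    (h : ∀ (R : TmRel) t s, f R t s → ∃ L : Set (Tm × Tm), L.Finite ∧ (∀ p ∈ L, R p.1 p.2) ∧
      f (fun t s => (t, s) ∈ L) t s) : IsContinuous f := by
  intro R t s
  constructor
  · intro hts
    obtain ⟨L, hL, hLR, hf⟩ := h R t s hts
    exact ⟨_, fun t s h => hLR (t, s) h, hL, hf⟩
  · rintro ⟨R₀, hR₀, -, hf⟩
    exact hmono _ _ hR₀ _ _ hf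

theorem TestVal.finite_support {R : TmRel} {v w : Tm} (h : TestVal R v w) :
    ∃ L : Set (Tm × Tm), L.Finite ∧ (∀ p ∈ L, R p.1 p.2) ∧
      TestVal (fun t s => (t, s) ∈ L) v w := by
  obtain ⟨hv, hw, x, hx, hx', hR⟩ := h
  exact ⟨{(_, _)}, Set.finite_singleton _, fun p hp => hp ▸ hR, hv, hw, x, hx, hx', rfl⟩

theorem TestCtx.finite_support {R : TmRel} {F F' : ECtx} (h : TestCtx R F F') :
    ∃ L : Set (Tm × Tm), L.Finite ∧ (∀ p ∈ L, R p.1 p.2) ∧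
      TestCtx (fun t s => (t, s) ∈ L) F F' := by
  cases h with
  | pure E E' x hE hE' hx hx' hR =>
    exact ⟨{(_, _)}, Set.finite_singleton _, fun p hp => hp ▸ hR,
      .pure _ _ x hE hE' hx hx' rfl⟩
  | reset F F' E E' x hE hE' h1 h2 h3 h4 hR hR' =>
    refine ⟨{(_, _), (_, _)}, Set.toFinite _, ?_,
      .reset _ _ _ _ x hE hE' h1 h2 h3 h4 (Or.inl rfl) (Or.inr rfl)⟩
    rintro p (rfl | rfl)
    · exact hR
    · exact hR'

theorem insert_support {R : TmRel} {t s : Tm} (h : R t s) {L : Set (Tm × Tm)}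
    (hL : ∀ p ∈ L, R p.1 p.2) : ∀ p ∈ insert (t, s) L, R p.1 p.2 := by
  rintro p (rfl | hp)
  · exact h
  · exact hL p hp

theorem le_insert_support (p : Tm × Tm) (L : Set (Tm × Tm)) :
    (fun t s => (t, s) ∈ L : TmRel) ≤ fun t s => (t, s) ∈ insert p L :=
  fun _ _ h => Or.inr h

theorem isContinuous_techniques : ∀ f ∈ techniques, IsContinuous f := by
  intro f hf
  rcases hf with rfl | rfl | rfl | rfl | rfl | rfl | rfl | rfl
  · refine .of_finite_support (fun R S h t s => ?_) fun R t s => ?_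
    · rintro ⟨t⟩; exact ⟨t⟩
    · rintro ⟨t⟩; exact ⟨∅, Set.finite_empty, by simp, ⟨t⟩⟩
  · refine .of_finite_support (fun R S h t s => ?_) fun R t s => ?_
    · rintro ⟨x, t, s, hts⟩; exact ⟨x, t, s, h _ _ hts⟩
    · rintro ⟨x, t, s, hts⟩
      exact ⟨{(t, s)}, Set.finite_singleton _, fun p hp => hp ▸ hts, ⟨x, t, s, rfl⟩⟩
  · refine .of_finite_support (fun R S h t s => ?_) fun R t s => ?_
    · rintro ⟨t, s, x, v, w, hts, hvw⟩; exact ⟨t, s, x, v, w, h _ _ hts, hvw.mono h⟩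
    · rintro ⟨t, s, x, v, w, hts, hvw⟩
      obtain ⟨L, hL, hLR, hvw⟩ := hvw.finite_support
      exact ⟨insert (t, s) L, hL.insert _, insert_support hts hLR,
        ⟨t, s, x, v, w, Or.inl rfl, hvw.mono (le_insert_support _ _)⟩⟩
  · refine .of_finite_support (fun R S h t s => ?_) fun R t s => ?_
    · rintro ⟨t, s, E, E', hts, hE, hE', hc⟩
      exact ⟨t, s, E, E', h _ _ hts, hE, hE', hc.mono h⟩
    · rintro ⟨t, s, E, E', hts, hE, hE', hc⟩
      obtain ⟨L, hL, hLR, hc⟩ := hc.finite_support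
      exact ⟨insert (t, s) L, hL.insert _, insert_support hts hLR,
        ⟨t, s, E, E', Or.inl rfl, hE, hE', hc.mono (le_insert_support _ _)⟩⟩
  · refine .of_finite_support (fun R S h t s => ?_) fun R t s => ?_
    · rintro ⟨t, s, E, E', hts, hE, hE', hc⟩
      exact ⟨t, s, E, E', h _ _ hts, hE, hE', hc.mono h⟩
    · rintro ⟨t, s, E, E', hts, hE, hE', hc⟩
      obtain ⟨L, hL, hLR, hc⟩ := hc.finite_support
      exact ⟨insert (t, s) L, hL.insert _, insert_support hts hLR,
        ⟨t, s, E, E', Or.inl rfl, hE, hE', hc.mono (le_insert_support _ _)⟩⟩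
  · refine .of_finite_support (fun R S h t s => ?_) fun R t s => ?_
    · rintro ⟨t, s, F, F', x, hts, ht, hs, hx, hx', hF⟩
      exact ⟨t, s, F, F', x, h _ _ hts, ht, hs, hx, hx', h _ _ hF⟩
    · rintro ⟨t, s, F, F', x, hts, ht, hs, hx, hx', hF⟩
      refine ⟨{(t, s), (_, _)}, Set.toFinite _, ?_,
        ⟨t, s, F, F', x, Or.inl rfl, ht, hs, hx, hx', Or.inr rfl⟩⟩
      rintro p (rfl | rfl)
      · exact hts
      · exact hF
  · refine .of_finite_support (fun R S h => h) fun R t s hts => ?_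
    exact ⟨{(t, s)}, Set.finite_singleton _, fun p hp => hp ▸ hts, rfl⟩
  · refine .of_finite_support (fun R S h t s => ?_) fun R t s => ?_
    · rintro ⟨t, s, t', s', ht, hs, hts⟩; exact ⟨t, s, t', s', ht, hs, h _ _ hts⟩
    · rintro ⟨t, s, t', s', ht, hs, hts⟩
      exact ⟨{(t', s')}, Set.finite_singleton _, fun p hp => hp ▸ hts, ⟨t, s, t', s', ht, hs, rfl⟩⟩

theorem TestVal.swap {R : TmRel} {v w : Tm} (h : TestVal R v w) :
    TestVal (Function.swap R) w v := by
  obtain ⟨hv, hw, x, hx, hx', hR⟩ := h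
  exact ⟨hw, hv, x, hx', hx, hR⟩

theorem TestCtx.swap {R : TmRel} {F F' : ECtx} (h : TestCtx R F F') :
    TestCtx (Function.swap R) F' F := by
  cases h with
  | pure E E' x hE hE' hx hx' hR => exact .pure _ _ x hE' hE hx' hx hR
  | reset F F' E E' x hE hE' h1 h2 h3 h4 hR hR' =>
    exact .reset _ _ _ _ x hE' hE h2 h1 h4 h3 hR hR'

/-- The techniques commute with taking the converse of a relation. -/
theorem technique_swap {f : RelFun} (hf : f ∈ techniques) {R : TmRel} {t s : Tm} (h : f R t s) :
    f (Function.swap R) s t := by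
  rcases hf with rfl | rfl | rfl | rfl | rfl | rfl | rfl | rfl
  · obtain ⟨t⟩ := h; exact ⟨t⟩
  · obtain ⟨x, t, s, hts⟩ := h; exact ⟨x, s, t, hts⟩
  · obtain ⟨t, s, x, v, w, hts, hvw⟩ := h; exact ⟨s, t, x, w, v, hts, hvw.swap⟩
  · obtain ⟨t, s, E, E', hts, hE, hE', hc⟩ := h; exact ⟨s, t, E', E, hts, hE', hE, hc.swap⟩
  · obtain ⟨t, s, E, E', hts, hE, hE', hc⟩ := h; exact ⟨s, t, E', E, hts, hE', hE, hc.swap⟩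
  · obtain ⟨t, s, F, F', x, hts, ht, hs, hx, hx', hF⟩ := h
    exact ⟨s, t, F', F, x, hts, hs, ht, hx', hx, hF⟩
  · exact h
  · obtain ⟨t, s, t', s', ht, hs, hts⟩ := h; exact ⟨s, t, s', t', hs, ht, hts⟩

/-! ### Testing with relations that are closed under the techniques -/

/-- The strong techniques, listed.  That this set is `strongTechniques`, i.e. that none of its
elements is one of the three context closures, is a consequence of the fact that its elements
strongly evolve while the context closures do not. -/
def baseTechniques : Set RelFun := {utRefl, utLam, utSubst, utId, utRed}

theorem baseTechniques_subset : baseTechniques ⊆ techniques := by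
  rintro f (rfl | rfl | rfl | rfl | rfl) <;> simp [techniques]

/-- Relations closed under the strong techniques. -/
def StrongClosed (X : TmRel) : Prop := ∀ f ∈ baseTechniques, f X ≤ X

/-- Relations closed under all the techniques. -/
def FullyClosed (X : TmRel) : Prop := ∀ f ∈ techniques, f X ≤ X

theorem FullyClosed.strong {X : TmRel} (hX : FullyClosed X) : StrongClosed X :=
  fun f hf => hX f (baseTechniques_subset hf)

theorem StrongClosed.swap {X : TmRel} (hX : StrongClosed X) : StrongClosed (Function.swap X) :=
  fun f hf _ _ h => hX f hf _ _ (technique_swap (baseTechniques_subset hf) h)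

theorem FullyClosed.swap {X : TmRel} (hX : FullyClosed X) : FullyClosed (Function.swap X) :=
  fun f hf _ _ h => hX f hf _ _ (technique_swap hf h)

/-- Two contexts send related values to related terms.  For a relation closed under the strong
techniques, this is the same as being related on a fresh variable. -/
def PlugRel (X : TmRel) (F F' : ECtx) : Prop :=
  ∀ v w, TestVal X v w → X (F.plug v) (F'.plug w)

theorem exists_fresh (x : ℕ) (t s : Tm) (F G : ECtx) :
    ∃ z, z ≠ x ∧ z ∉ t.fv ∧ z ∉ s.fv ∧ z ∉ F.fv ∧ z ∉ G.fv := by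
  obtain ⟨z, hz⟩ := ((Set.finite_singleton x).union (t.fv_finite.union (s.fv_finite.union
    (F.fv_finite.union G.fv_finite)))).exists_notMem
  simp only [Set.mem_union, Set.mem_singleton_iff, not_or] at hz
  exact ⟨z, hz⟩


theorem TestVal.of_forall {X : TmRel} {v w : Tm} (hv : v.IsValue) (hw : w.IsValue)
    (h : ∀ x, X (.app v (.var x)) (.app w (.var x))) : TestVal X v w := by
  obtain ⟨z, -, hz, hz', -⟩ := exists_fresh 0 v w .hole .hole
  exact ⟨hv, hw, z, hz, hz', h z⟩

theorem TestCtx.pure_of_forall {X : TmRel} {E E' : ECtx} (hE : E.Pure) (hE' : E'.Pure)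
    (h : ∀ x, X (E.plug (.var x)) (E'.plug (.var x))) : TestCtx X E E' := by
  obtain ⟨z, -, -, -, hz, hz'⟩ := exists_fresh 0 .shift .shift E E'
  exact .pure E E' z hE hE' hz hz' (h z)

theorem TestCtx.reset_of_forall {X : TmRel} {F F' E E' : ECtx} (hE : E.Pure) (hE' : E'.Pure)
    (hEE : ∀ x, X (.reset (E.plug (.var x))) (.reset (E'.plug (.var x))))
    (hFF : ∀ x, X (F.plug (.var x)) (F'.plug (.var x))) :
    TestCtx X (F.comp (.reset E)) (F'.comp (.reset E')) := by
  obtain ⟨z, hz⟩ := ((F.fv_finite.union F'.fv_finite).union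
    (E.fv_finite.union E'.fv_finite)).exists_notMem
  simp only [Set.mem_union, not_or] at hz
  exact .reset F F' E E' z hE hE' hz.1.1 hz.1.2 hz.2.1 hz.2.2 (hEE z) (hFF z)

theorem TestCtrl.of_forall {X : TmRel} {E E' : ECtx} {v w : Tm} (hE : E.Pure)
    (hE' : E'.Pure) (hv : v.IsValue) (hw : w.IsValue) (hEE : TestCtx X E E')
    (h : ∀ x, X (.reset (.app v (.var x))) (.reset (.app w (.var x)))) :
    TestCtrl X (E.plug (.app .shift v)) (E'.plug (.app .shift w)) := by
  obtain ⟨z, -, hz, hz', -⟩ := exists_fresh 0 v w .hole .hole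
  exact ⟨E, E', v, w, z, hE, hE', hv, hw, hEE, hz, hz', h z⟩

namespace StrongClosed

theorem refl {X : TmRel} (hX : StrongClosed X) (t : Tm) : X t t :=
  hX utRefl (by simp [baseTechniques]) _ _ ⟨t⟩

theorem subst {X : TmRel} (hX : StrongClosed X) {t s v w : Tm} (h : X t s) (x : ℕ)
    (hvw : TestVal X v w) : X (t.subst x v) (s.subst x w) :=
  hX utSubst (by simp [baseTechniques]) _ _ ⟨t, s, x, v, w, h, hvw⟩

theorem red {X : TmRel} (hX : StrongClosed X) {t s t' s' : Tm} (ht : Steps t t')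
    (hs : Steps s s') (h : X t' s') : X t s :=
  hX utRed (by simp [baseTechniques]) _ _ ⟨t, s, t', s', ht, hs, h⟩

theorem testVal_refl {X : TmRel} (hX : StrongClosed X) {v : Tm} (hv : v.IsValue) :
    TestVal X v v :=
  .of_forall hv hv fun _ => hX.refl _

theorem app {X : TmRel} (hX : StrongClosed X) {v w a b : Tm} (h : TestVal X v w)
    (hab : TestVal X a b) : X (.app v a) (.app w b) := by
  obtain ⟨hv, hw, x, hx, hx', hR⟩ := h
  have := hX.subst hR x hab
  simpa [Tm.subst_of_notMem hx, Tm.subst_of_notMem hx'] using this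

theorem testVal_subst {X : TmRel} (hX : StrongClosed X) {v w a b : Tm} (h : TestVal X v w)
    (x : ℕ) (hab : TestVal X a b) : TestVal X (v.subst x a) (w.subst x b) := by
  obtain ⟨z, hzx, hz, hz', -⟩ := exists_fresh x (v.subst x a) (w.subst x b) .hole .hole
  refine ⟨h.1.subst hab.1 x, h.2.1.subst hab.2.1 x, z, hz, hz', ?_⟩
  have hz : X (.app v (.var z)) (.app w (.var z)) := hX.app h (hX.testVal_refl (v := .var z) trivial)
  simpa [Tm.subst_var_ne hzx] using hX.subst hz x hab

theorem plugRel_of_fresh {X : TmRel} (hX : StrongClosed X) {F F' : ECtx} {x : ℕ}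
    (hx : x ∉ F.fv) (hx' : x ∉ F'.fv) (h : X (F.plug (.var x)) (F'.plug (.var x))) :
    PlugRel X F F' := by
  intro v w hvw
  have := hX.subst h x hvw
  rwa [ECtx.plug_var_subst hx hvw.1, ECtx.plug_var_subst hx' hvw.2.1] at this

theorem plug_var {X : TmRel} (hX : StrongClosed X) {F F' : ECtx} (h : PlugRel X F F') (x : ℕ) :
    X (F.plug (.var x)) (F'.plug (.var x)) :=
  h _ _ (hX.testVal_refl trivial)

theorem plugRel_subst {X : TmRel} (hX : StrongClosed X) {F F' : ECtx} (h : PlugRel X F F')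
    (x : ℕ) {v w : Tm} (hvw : TestVal X v w) :
    PlugRel X (F.subst x v hvw.1) (F'.subst x w hvw.2.1) := by
  obtain ⟨z, hzx, -, -, hz, hz'⟩ :=
    exists_fresh x v w (F.subst x v hvw.1) (F'.subst x w hvw.2.1)
  refine hX.plugRel_of_fresh hz hz' ?_
  have := hX.subst (hX.plug_var h z) x hvw
  rwa [ECtx.plug_subst _ _ _ _ hvw.1, ECtx.plug_subst _ _ _ _ hvw.2.1,
    Tm.subst_var_ne hzx, Tm.subst_var_ne hzx] at this

theorem plugRel_hole {X : TmRel} (hX : StrongClosed X) : PlugRel X .hole .hole := by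
  obtain ⟨z, -, -, -, hz, hz'⟩ := exists_fresh 0 .shift .shift .hole .hole
  exact hX.plugRel_of_fresh hz hz' (hX.refl _)

/-- The premise of the test of control-stuck terms, as a test of contexts. -/
theorem plugRel_reset_appR {X : TmRel} (hX : StrongClosed X) {v w : Tm} (hv : v.IsValue)
    (hw : w.IsValue) {x : ℕ} (hx : x ∉ v.fv) (hx' : x ∉ w.fv)
    (h : X (.reset (.app v (.var x))) (.reset (.app w (.var x)))) :
    PlugRel X (.reset (.appR v hv .hole)) (.reset (.appR w hw .hole)) :=
  hX.plugRel_of_fresh (x := x) (by simpa [ECtx.fv] using hx) (by simpa [ECtx.fv] using hx') h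

theorem testCtx_pure {X : TmRel} (hX : StrongClosed X) {E E' : ECtx} (hE : E.Pure)
    (hE' : E'.Pure) (h : PlugRel X E E') : TestCtx X E E' :=
  .pure_of_forall hE hE' (hX.plug_var h)

theorem testCtx_reset {X : TmRel} (hX : StrongClosed X) {F F' E E' : ECtx} (hE : E.Pure)
    (hE' : E'.Pure) (hEE : PlugRel X (.reset E) (.reset E')) (hFF : PlugRel X F F') :
    TestCtx X (F.comp (.reset E)) (F'.comp (.reset E')) :=
  .reset_of_forall hE hE' (hX.plug_var hEE) (hX.plug_var hFF)

theorem testCtx_cases {X : TmRel} (hX : StrongClosed X) {F F' : ECtx} (h : TestCtx X F F') :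
    (F.Pure ∧ F'.Pure ∧ PlugRel X F F') ∨
    ∃ G G' E E' : ECtx, E.Pure ∧ E'.Pure ∧ F = G.comp (.reset E) ∧ F' = G'.comp (.reset E') ∧
      PlugRel X (.reset E) (.reset E') ∧ PlugRel X G G' := by
  cases h with
  | pure E E' x hE hE' hx hx' hR => exact Or.inl ⟨hE, hE', hX.plugRel_of_fresh hx hx' hR⟩
  | reset G G' E E' x hE hE' h1 h2 h3 h4 hR hR' =>
    exact Or.inr ⟨G, G', E, E', hE, hE', rfl, rfl,
      hX.plugRel_of_fresh (F := .reset E) (F' := .reset E') h3 h4 hR,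
      hX.plugRel_of_fresh h1 h2 hR'⟩

theorem plugRel_of_testCtx {X : TmRel} (hX : StrongClosed X) {E E' : ECtx} (h : TestCtx X E E')
    (hE : E.Pure) : PlugRel X E E' := by
  rcases hX.testCtx_cases h with ⟨-, -, h⟩ | ⟨_, _, _, _, -, -, rfl, -⟩
  · exact h
  · exact (ECtx.not_pure_comp_reset _ _ hE).elim

theorem testCtx_subst {X : TmRel} (hX : StrongClosed X) {F F' : ECtx} (h : TestCtx X F F')
    (x : ℕ) {v w : Tm} (hvw : TestVal X v w) :
    TestCtx X (F.subst x v hvw.1) (F'.subst x w hvw.2.1) := by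
  rcases hX.testCtx_cases h with ⟨hE, hE', h⟩ | ⟨G, G', E, E', hE, hE', rfl, rfl, h, h'⟩
  · exact hX.testCtx_pure (hE.bind _ _) (hE'.bind _ _) (hX.plugRel_subst h x hvw)
  · have := hX.testCtx_reset (hE.bind _ _) (hE'.bind _ _) (hX.plugRel_subst h x hvw)
      (hX.plugRel_subst h' x hvw)
    rwa [ECtx.subst, ECtx.subst, ECtx.comp_bind, ECtx.comp_bind]

theorem testCtrl {X : TmRel} (hX : StrongClosed X) {E E' : ECtx} {v w : Tm} (hE : E.Pure)
    (hE' : E'.Pure) (hv : v.IsValue) (hw : w.IsValue) (hEE : TestCtx X E E')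
    (h : PlugRel X (.reset (.appR v hv .hole)) (.reset (.appR w hw .hole))) :
    TestCtrl X (E.plug (.app .shift v)) (E'.plug (.app .shift w)) :=
  .of_forall hE hE' hv hw hEE (hX.plug_var h)

theorem testVal_reify {X : TmRel} (hX : StrongClosed X) {E E' : ECtx}
    (h : PlugRel X (.reset E) (.reset E')) : TestVal X E.reify E'.reify :=
  .of_forall trivial trivial fun x => hX.red (.single (step_reify_app E (v := .var x) trivial))
    (.single (step_reify_app E' (v := .var x) trivial)) (hX.plug_var h x)

end StrongClosed

namespace FullyClosed

theorem plug_pure {X : TmRel} (hX : FullyClosed X) {E E' : ECtx} (hE : E.Pure) (hE' : E'.Pure)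
    (h : PlugRel X E E') {t s : Tm} (hts : X t s) : X (E.plug t) (E'.plug s) :=
  hX utPctx (by simp [techniques]) _ _
    ⟨t, s, E, E', hts, hE, hE', hX.strong.testCtx_pure hE hE' h⟩

theorem plug_reset {X : TmRel} (hX : FullyClosed X) {E E' : ECtx} (hE : E.Pure) (hE' : E'.Pure)
    (h : PlugRel X (.reset E) (.reset E')) {t s : Tm} (hts : X t s) :
    X (.reset (E.plug t)) (.reset (E'.plug s)) :=
  hX utPctxReset (by simp [techniques]) _ _ ⟨t, s, E, E', hts, hE, hE',
    hX.strong.testCtx_reset hE hE' h hX.strong.plugRel_hole⟩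

theorem plug_isPure {X : TmRel} (hX : FullyClosed X) {F F' : ECtx} (h : PlugRel X F F')
    {t s : Tm} (hts : X t s) (ht : t.IsPure) (hs : s.IsPure) : X (F.plug t) (F'.plug s) := by
  obtain ⟨z, -, -, -, hz, hz'⟩ := exists_fresh 0 .shift .shift F F'
  exact hX utEctxPure (by simp [techniques]) _ _
    ⟨t, s, F, F', z, hts, ht, hs, hz, hz', hX.strong.plug_var h z⟩

/-- Related terms in related evaluation contexts are related. -/
theorem plug {X : TmRel} (hX : FullyClosed X) {F F' : ECtx} (h : TestCtx X F F') {t s : Tm}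
    (hts : X t s) : X (F.plug t) (F'.plug s) := by
  rcases hX.strong.testCtx_cases h with ⟨hE, hE', h⟩ | ⟨G, G', E, E', hE, hE', rfl, rfl, h, h'⟩
  · exact hX.plug_pure hE hE' h hts
  · rw [ECtx.plug_comp, ECtx.plug_comp]
    exact hX.plug_isPure h' (hX.plug_reset hE hE' h hts) trivial trivial

/-- Tests of evaluation contexts are stable under composition. -/
theorem testCtx_comp {X : TmRel} (hX : FullyClosed X) {F F' G G' : ECtx} (hF : TestCtx X F F')
    (hG : TestCtx X G G') : TestCtx X (F.comp G) (F'.comp G') := by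
  rcases hX.strong.testCtx_cases hG with ⟨hE, hE', h⟩ | ⟨H, H', E, E', hE, hE', rfl, rfl, h, h'⟩
  · rcases hX.strong.testCtx_cases hF with
      ⟨hE₀, hE₀', h₀⟩ | ⟨H, H', E₀, E₀', hE₀, hE₀', rfl, rfl, h₀, h₀'⟩
    · refine hX.strong.testCtx_pure (hE₀.comp hE) (hE₀'.comp hE') fun v w hvw => ?_
      rw [ECtx.plug_comp, ECtx.plug_comp]
      exact hX.plug_pure hE₀ hE₀' h₀ (h v w hvw)
    · rw [ECtx.comp_assoc, ECtx.comp_assoc]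
      refine hX.strong.testCtx_reset (hE₀.comp hE) (hE₀'.comp hE') (fun v w hvw => ?_) h₀'
      simp only [ECtx.plug, ECtx.plug_comp]
      exact hX.plug_reset hE₀ hE₀' h₀ (h v w hvw)
  · rw [← ECtx.comp_assoc, ← ECtx.comp_assoc]
    refine hX.strong.testCtx_reset hE hE' h fun v w hvw => ?_
    rw [ECtx.plug_comp, ECtx.plug_comp]
    exact hX.plug hF (h' v w hvw)

end FullyClosed

/-! ### Evolution of the techniques -/

theorem ECtx.isPure_plug_of_comp_reset {H E : ECtx} {r v : Tm}
    (h : ((H.comp (.reset E)).plug r).IsPure) (hv : v.IsValue) : (H.plug v).IsPure := by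
  cases H with
  | hole => exact hv.isPure
  | reset => trivial
  | _ => exact h.elim

/-- The main step of the substitutive closure: a test of values makes a stuck call `G[x a]`
progress when tested values are substituted for `x`. -/
theorem halfClauses_app {R S T S' T' : TmRel} (hR : HalfProgress R S T) (hT : T ≤ T')
    (hT' : FullyClosed T') {v w a b : Tm} {G G' : ECtx} (hvw : TestVal R v w)
    (hG : TestCtx T' G G') (hab : TestVal T' a b) :
    HalfClauses S' T' (G.plug (.app v a)) (G'.plug (.app w b)) := by
  have hX := hT'.strong
  obtain ⟨hv, hw, z, hz, hz', hzz⟩ := hvw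
  have ha := hab.1
  have hb := hab.2.1
  have hva : (Tm.app v (.var z)).subst z a = .app v a := by
    simp [Tm.subst_of_notMem hz]
  have hwb : (Tm.app w (.var z)).subst z b = .app w b := by
    simp [Tm.subst_of_notMem hz']
  have hsteps : ∀ {u}, Steps (.app w (.var z)) u →
      Steps (G'.plug (.app w b)) (G'.plug (u.subst z b)) := fun h => by
    have := (h.subst z hb).plug G'
    rwa [hwb] at this
  rcases (hR.clauses hzz).cases with ⟨t', s', ht, hs, h⟩ | ⟨u, -, hu⟩ |
    ⟨F, F', y, u, u', e, hs, hF, hu⟩ | ⟨E, E', u, u', x, hE, hE', hu, hu', e, hs, hF, hx, hx', h⟩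
  · have ht := (ht.subst z ha).plug G
    rw [hva] at ht
    exact .of_step ht (hsteps hs) (hT'.plug hG (hX.subst (hT _ _ h) z hab))
  · exact hu.1.elim
  · obtain ⟨rfl, e⟩ := Active.plug_inj (F := .hole)
      (.app hv (w := .var z) trivial) (.var_app y hu.1) e
    cases e
    have hzy : y ≠ z := fun h => hz (h ▸ rfl)
    have hs := hsteps hs
    rw [ECtx.plug_subst _ _ _ _ hb, Tm.subst_app, Tm.subst_var_ne hzy, ← ECtx.plug_comp] at hs
    have hu := hX.testVal_subst (hu.mono hT) z hab
    rw [Tm.subst_var_self] at hu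
    have hctx : TestCtx T' .hole (F'.subst z b hb) := hX.testCtx_subst (hF.mono hT) z hab
    have hcomp := hT'.testCtx_comp hG hctx
    rw [ECtx.comp_hole] at hcomp
    exact .of_open hs hcomp hu
  · obtain ⟨rfl, e⟩ := Active.plug_inj (F := .hole)
      (.app hv (w := .var z) trivial) (.shift_app hu) e
    cases e
    have hs := hsteps hs
    rw [ECtx.plug_subst _ _ _ _ hb, Tm.subst_app, Tm.subst_shift] at hs
    have hctx : TestCtx T' .hole (E'.subst z b hb) := hX.testCtx_subst (hF.mono hT) z hab
    have hcomp := hT'.testCtx_comp hG hctx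
    rw [ECtx.comp_hole] at hcomp
    have hpure : (E'.subst z b hb).Pure := hE'.bind _ _
    have hu'b := hu'.subst hb z
    have hplug : PlugRel T' (.reset (.appR a ha .hole))
        (.reset (.appR (u'.subst z b) hu'b .hole)) := by
      have := hX.plugRel_subst (hX.plugRel_reset_appR hu hu' hx hx' (hT _ _ h)) z hab
      simpa [ECtx.subst, ECtx.bind, Tm.bind, Tm.single, Tm.subst_eq_bind] using this
    rcases hX.testCtx_cases hG with ⟨hP, hP', -⟩ | ⟨H, H', P, P', hP, hP', rfl, rfl, hPP, hHH⟩
    · rw [← ECtx.plug_comp] at hs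
      exact .of_ctrl hs (hX.testCtrl hP (hP'.comp hpure) ha hu'b
        hcomp hplug) hP (hP'.comp hpure) ha hu'b
    · -- The enclosing `reset` captures on both sides: `P` on the left, and on the right `P'`
      -- composed with the context in which `w b` gets stuck.
      have hcap : TestVal T' P.reify (P'.comp (E'.subst z b hb)).reify := by
        refine hX.testVal_reify fun c d hcd => ?_
        simp only [ECtx.plug, ECtx.plug_comp]
        refine hT'.plug_reset hP hP' hPP ?_
        exact hX.plugRel_of_testCtx hctx trivial c d hcd
      simp only [ECtx.plug_comp, ECtx.plug] at hs ⊢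
      rw [← ECtx.plug_comp P'] at hs
      exact .of_step (.capture H P a hP ha)
        (hs.tail (.capture H' _ _ (hP'.comp hpure) hu'b))
        (hT'.plug_isPure hHH (hplug _ _ hcap) trivial trivial)

theorem halfProgress_subst {R S T S' T' : TmRel} (h : Progress R S T) (hS : S ≤ S')
    (hT : T ≤ T') (hS' : StrongClosed S') (hT' : FullyClosed T') :
    HalfProgress (utSubst R) S' T' := by
  have hX := hT'.strong
  refine .intro ?_
  rintro _ _ ⟨t, s, x, a, b, hts, hab⟩
  have hST : S ≤ T := h.2.1
  have habS : TestVal S' a b := hab.mono (h.1.trans hS)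
  have habT : TestVal T' a b := hab.mono (h.1.trans (hST.trans hT))
  have ha := hab.1
  have hb := hab.2.1
  rcases (h.2.2.1.clauses hts).cases with ⟨t', s', ht, hs, h'⟩ | ⟨u, hs, hu⟩ |
    ⟨F, F', y, u, u', rfl, hs, hF, hu⟩ |
    ⟨E, E', u, u', z, hE, hE', hu, hu', rfl, hs, hF, hz, hz', h'⟩
  · exact .of_step (ht.subst x ha) (hs.subst x hb) (hX.subst (hT _ _ h') x habT)
  · exact .of_value (hs.subst x hb) (hS'.testVal_subst (hu.mono hS) x habS)
  · have hs := hs.subst x hb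
    have hF := hX.testCtx_subst (hF.mono hT) x habT
    have hu := hX.testVal_subst (hu.mono hT) x habT
    rw [ECtx.plug_subst _ _ _ _ hb, Tm.subst_app] at hs
    rw [ECtx.plug_subst _ _ _ _ ha, Tm.subst_app]
    by_cases hyx : y = x
    · subst hyx
      rw [Tm.subst_var_self] at hs ⊢
      exact (halfClauses_app h.2.2.1 hT hT' hab hF hu).expand_right hs
    · rw [Tm.subst_var_ne hyx] at hs ⊢
      exact .of_open hs hF hu
  · have hs := hs.subst x hb
    have hF := hX.testCtx_subst (hF.mono hT) x habT
    rw [ECtx.plug_subst _ _ _ _ hb, Tm.subst_app] at hs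
    rw [ECtx.plug_subst _ _ _ _ ha, Tm.subst_app]
    refine .of_ctrl hs (hX.testCtrl (hE.bind _ _) (hE'.bind _ _) (hu.subst ha x)
      (hu'.subst hb x) hF ?_) (hE.bind _ _) (hE'.bind _ _) (hu.subst ha x) (hu'.subst hb x)
    exact hX.plugRel_subst (hX.plugRel_reset_appR hu hu' hz hz' (hT _ _ h')) x habT

theorem halfProgress_refl {R S' T' : TmRel} (hS' : StrongClosed S') (hT' : FullyClosed T') :
    HalfProgress (utRefl R) S' T' := by
  have hX := hT'.strong
  have hP : ∀ F : ECtx, PlugRel T' F F := fun F => by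
    obtain ⟨z, -, -, -, hz, hz'⟩ := exists_fresh 0 .shift .shift F F
    exact hX.plugRel_of_fresh hz hz' (hX.refl _)
  have hC : ∀ F : ECtx, TestCtx T' F F := fun F => by
    rcases F.pure_or_reset with hF | ⟨G, E, hE, rfl⟩
    · exact hX.testCtx_pure hF hF (hP F)
    · exact hX.testCtx_reset hE hE (hP _) (hP G)
  refine .intro ?_
  rintro t _ ⟨⟩
  rcases step_or_normal t with ⟨t', ht⟩ | ht | ⟨F, x, v, hv, rfl⟩ | ⟨E, v, hE, hv, rfl⟩
  · exact .of_step ht (.single ht) (hX.refl t')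
  · exact .of_value .refl (hS'.testVal_refl ht)
  · exact .of_open .refl (hC F) (hX.testVal_refl hv)
  · exact .of_ctrl .refl (hX.testCtrl hE hE hv hv (hC E) (hP _)) hE hE hv hv

theorem halfProgress_lam {R S' T' : TmRel} (hR : R ≤ S') (hS' : StrongClosed S') :
    HalfProgress (utLam R) S' T' := by
  refine .intro ?_
  rintro _ _ ⟨x, t, s, hts⟩
  refine .of_value .refl (.of_forall trivial trivial fun z => ?_)
  exact hS'.red (.single (step_abs_app x t (v := .var z) trivial))
    (.single (step_abs_app x s (v := .var z) trivial))
    (hS'.subst (hR _ _ hts) x (hS'.testVal_refl trivial))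

theorem halfProgress_red {R S T S' T' : TmRel} (h : Progress R S T) (hS : S ≤ S')
    (hT : T ≤ T') (hT' : FullyClosed T') : HalfProgress (utRed R) S' T' := by
  refine .intro ?_
  rintro _ _ ⟨t, s, t', s', ht, hs, hts⟩
  rcases Relation.ReflTransGen.cases_head ht with rfl | ⟨u, hu, hut⟩
  · exact ((h.2.2.1.clauses hts).mono hS hT).expand_right hs
  · exact .of_step hu .refl (hT'.strong.red hut hs (hT _ _ (h.2.1 _ _ (h.1 _ _ hts))))

/-- A term in an evaluation context, when the term is a value: the context is tested on a fresh
variable, for which the value is then substituted. -/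
theorem halfClauses_plug_value {R S' T' : TmRel} {T : TmRel} (h : Progress R R T) (hS : R ≤ S')
    (hT : T ≤ T') (hS' : StrongClosed S') (hT' : FullyClosed T') {F F' : ECtx} {x : ℕ}
    (hx : x ∉ F.fv) (hx' : x ∉ F'.fv) (hF : R (F.plug (.var x)) (F'.plug (.var x)))
    {t s w : Tm} (hs : Steps s w) (hw : TestVal R t w) :
    HalfClauses S' T' (F.plug t) (F'.plug s) := by
  have := (halfProgress_subst h hS hT hS' hT').clauses (.mk _ _ x t w hF hw)
  rw [ECtx.plug_var_subst hx hw.1, ECtx.plug_var_subst hx' hw.2.1] at this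
  exact this.expand_right (hs.plug F')

theorem halfProgress_pctx {R T S' T' : TmRel} (h : Progress R R T) (hS : R ≤ S')
    (hT : T ≤ T') (hS' : StrongClosed S') (hT' : FullyClosed T') :
    HalfProgress (utPctx R) S' T' := by
  have hX := hT'.strong
  refine .intro ?_
  rintro _ _ ⟨t, s, E, E', hts, hE, hE', hEE⟩
  have hC : TestCtx T' E E' := hEE.mono (h.2.1.trans hT)
  rcases (h.2.2.1.clauses hts).cases with ⟨t', s', ht, hs, h'⟩ | ⟨w, hs, hw⟩ |
    ⟨G, G', y, u, u', rfl, hs, hG, hu⟩ |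
    ⟨G, G', u, u', z, hG, hG', hu, hu', rfl, hs, hGG, hz, hz', h'⟩
  · exact .of_step (ht.plug E) (hs.plug E') (hT'.plug hC (hT _ _ h'))
  · cases hEE with
    | pure _ _ x _ _ hx hx' hR => exact halfClauses_plug_value h hS hT hS' hT' hx hx' hR hs hw
    | reset => exact (ECtx.not_pure_comp_reset _ _ hE).elim
  · have hs := hs.plug E'
    rw [← ECtx.plug_comp] at hs ⊢
    exact .of_open hs (hT'.testCtx_comp hC (hG.mono hT)) (hu.mono hT)
  · have hs := hs.plug E'
    rw [← ECtx.plug_comp] at hs ⊢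
    exact .of_ctrl hs (hX.testCtrl (hE.comp hG) (hE'.comp hG') hu hu'
      (hT'.testCtx_comp hC (hGG.mono hT)) (hX.plugRel_reset_appR hu hu' hz hz' (hT _ _ h')))
      (hE.comp hG) (hE'.comp hG') hu hu'

theorem halfProgress_pctxReset {R T S' T' : TmRel} (h : Progress R R T) (hS : R ≤ S')
    (hT : T ≤ T') (hS' : StrongClosed S') (hT' : FullyClosed T') :
    HalfProgress (utPctxReset R) S' T' := by
  have hX := hT'.strong
  refine .intro ?_
  rintro _ _ ⟨t, s, E, E', hts, hE, hE', hEE⟩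
  have hC : TestCtx T' (.reset E) (.reset E') := hEE.mono (h.2.1.trans hT)
  rcases (h.2.2.1.clauses hts).cases with ⟨t', s', ht, hs, h'⟩ | ⟨w, hs, hw⟩ |
    ⟨G, G', y, u, u', rfl, hs, hG, hu⟩ |
    ⟨G, G', u, u', z, hG, hG', hu, hu', rfl, hs, hGG, hz, hz', h'⟩
  · exact .of_step (ht.plug (.reset E)) (hs.plug (.reset E')) (hT'.plug hC (hT _ _ h'))
  · generalize e : ECtx.reset E = F at hEE
    generalize e' : ECtx.reset E' = F' at hEE
    cases hEE with
    | pure _ _ x hP => exact (e ▸ hP : (ECtx.reset E).Pure).elim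
    | reset F F' P P' x hP hP' _ _ hx hx' hR =>
      obtain ⟨-, rfl⟩ := ECtx.comp_reset_inj (F := .hole) hE hP e
      obtain ⟨-, rfl⟩ := ECtx.comp_reset_inj (F := .hole) hE' hP' e'
      exact halfClauses_plug_value (F := .reset E) (F' := .reset E') h hS hT hS' hT' hx hx' hR hs hw
  · have hs := hs.plug (.reset E')
    rw [← ECtx.plug_comp] at hs
    have := HalfClauses.of_open (S := S') hs (hT'.testCtx_comp hC (hG.mono hT)) (hu.mono hT)
    rwa [ECtx.plug_comp] at this
  · have hs := hs.plug (.reset E')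
    simp only [ECtx.plug] at hs
    rw [← ECtx.plug_comp] at hs ⊢
    have hcap : TestVal T' (E.comp G).reify (E'.comp G').reify := by
      refine hX.testVal_reify fun c d hcd => ?_
      simp only [ECtx.plug, ECtx.plug_comp]
      refine hT'.plug hC (t := G.plug c) (s := G'.plug d) ?_
      exact hX.plugRel_of_testCtx (hGG.mono hT) hG c d hcd
    exact .of_step (.capture .hole _ _ (hE.comp hG) hu)
      (hs.tail (.capture .hole _ _ (hE'.comp hG') hu'))
      (hX.plugRel_reset_appR hu hu' hz hz' (hT _ _ h') _ _ hcap)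

theorem halfProgress_ectxPure {R T S' T' : TmRel} (h : Progress R R T) (hS : R ≤ S')
    (hT : T ≤ T') (hS' : StrongClosed S') (hT' : FullyClosed T') :
    HalfProgress (utEctxPure R) S' T' := by
  have hX := hT'.strong
  refine .intro ?_
  rintro _ _ ⟨t, s, F, F', x, hts, htp, hsp, hx, hx', hF⟩
  have hC : PlugRel T' F F' := hX.plugRel_of_fresh hx hx' (hT _ _ (h.2.1 _ _ hF))
  rcases (h.2.2.1.clauses hts).cases with ⟨t', s', ht, hs, h'⟩ | ⟨w, hs, hw⟩ |
    ⟨G, G', y, u, u', rfl, hs, hG, hu⟩ |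
    ⟨G, G', u, u', z, hG, hG', hu, hu', rfl, hs, hGG, hz, hz', h'⟩
  · exact .of_step (ht.plug F) (hs.plug F')
      (hT'.plug_isPure hC (hT _ _ h') (ht.isPure htp) (hs.isPure hsp))
  · exact halfClauses_plug_value h hS hT hS' hT' hx hx' hF hs hw
  · have hsp' := hs.isPure hsp
    rcases hX.testCtx_cases (hG.mono hT) with
      ⟨hE, -, -⟩ | ⟨H, H', E, E', hE, hE', rfl, rfl, hEE, hHH⟩
    · -- A pure term that is not a value starts with a `reset`.
      cases G <;> first | exact htp.elim | exact hE.elim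
    · have hctx : TestCtx T' ((F.comp H).comp (.reset E)) ((F'.comp H').comp (.reset E')) := by
        refine hX.testCtx_reset hE hE' hEE fun c d hcd => ?_
        rw [ECtx.plug_comp, ECtx.plug_comp]
        exact hT'.plug_isPure hC (hHH c d hcd) (ECtx.isPure_plug_of_comp_reset htp hcd.1)
          (ECtx.isPure_plug_of_comp_reset hsp' hcd.2.1)
      have hs := hs.plug F'
      rw [← ECtx.plug_comp, ← ECtx.comp_assoc] at hs ⊢
      exact .of_open hs hctx (hu.mono hT)
  · cases G <;> first | exact htp.elim | exact hG.elim

/-! ### Diacritical compatibility -/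

theorem halfProgress_of_mem_base {f : RelFun} (hf : f ∈ baseTechniques) {R S T S' T' : TmRel}
    (h : Progress R S T) (hS : S ≤ S') (hT : T ≤ T') (hS' : StrongClosed S')
    (hT' : FullyClosed T') : HalfProgress (f R) S' T' := by
  rcases hf with rfl | rfl | rfl | rfl | rfl
  · exact halfProgress_refl hS' hT'
  · exact halfProgress_lam (h.1.trans hS) hS'
  · exact halfProgress_subst h hS hT hS' hT'
  · exact .intro fun t s hts => (h.2.2.1.clauses hts).mono hS hT
  · exact halfProgress_red h hS hT hT'

theorem mem_techniques_iff {f : RelFun} :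
    f ∈ techniques ↔ f ∈ baseTechniques ∨ f ∈ ({utPctx, utPctxReset, utEctxPure} : Set RelFun) := by
  simp only [techniques, baseTechniques, Set.mem_insert_iff, Set.mem_singleton_iff]
  tauto

theorem halfProgress_of_mem_techniques {f : RelFun} (hf : f ∈ techniques) {R T S' T' : TmRel}
    (h : Progress R R T) (hS : R ≤ S') (hT : T ≤ T') (hS' : StrongClosed S')
    (hT' : FullyClosed T') : HalfProgress (f R) S' T' := by
  rcases mem_techniques_iff.1 hf with hf | rfl | rfl | rfl
  · exact halfProgress_of_mem_base hf h hS hT hS' hT'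
  · exact halfProgress_pctx h hS hT hS' hT'
  · exact halfProgress_pctxReset h hS hT hS' hT'
  · exact halfProgress_ectxPure h hS hT hS' hT'

theorem isContinuous_base : ∀ f ∈ baseTechniques, IsContinuous f :=
  fun f hf => isContinuous_techniques f (baseTechniques_subset hf)

theorem strongClosed_closure (R : TmRel) : StrongClosed (closure baseTechniques R) :=
  fun _ hf => apply_closure_le isContinuous_base hf R

theorem fullyClosed_closure (R : TmRel) : FullyClosed (closure techniques R) :=
  fun _ hf => apply_closure_le isContinuous_techniques hf R

theorem closure_base_le {R X : TmRel} (h : R ≤ X) (hX : FullyClosed X) :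
    closure baseTechniques R ≤ X :=
  closure_le isContinuous_base h hX.strong

theorem stronglyEvolves_of_mem_base {f : RelFun} (hf : f ∈ baseTechniques) :
    StronglyEvolves f (closure baseTechniques) (closure techniques) := by
  intro R S T h
  have hS := le_closure (𝓕 := baseTechniques) S
  have hT := le_closure (𝓕 := techniques) T
  have hS' := strongClosed_closure S
  have hT' := fullyClosed_closure T
  refine ⟨?_, closure_base_le (h.2.1.trans hT) hT',
    halfProgress_of_mem_base hf h hS hT hS' hT', fun t s hts => ?_⟩
  · exact ((isContinuous_base f hf).mono (h.1.trans hS)).trans (hS' f hf)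
  · exact halfProgress_of_mem_base hf h.swap (fun _ _ h => hS _ _ h) (fun _ _ h => hT _ _ h)
      hS'.swap hT'.swap t s (technique_swap (baseTechniques_subset hf) hts)

theorem evolves_of_mem_techniques {f : RelFun} (hf : f ∈ techniques) :
    Evolves f (fun R => closure baseTechniques
      (hat (unionFun techniques) (closure baseTechniques R))) (closure techniques) := by
  intro R T h
  have hS := le_closure (𝓕 := baseTechniques) R
  have hT := le_closure (𝓕 := techniques) T
  have hS' := strongClosed_closure R
  have hT' := fullyClosed_closure T
  have hST : closure baseTechniques R ≤ closure techniques T :=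
    closure_base_le (h.2.1.trans hT) hT'
  have hle : closure baseTechniques R ≤
      closure baseTechniques (hat (unionFun techniques) (closure baseTechniques R)) :=
    (le_hat _ _).trans (le_closure _)
  refine ⟨fun t s hts => ?_, ?_, fun t s hts => ?_, fun t s hts => ?_⟩
  · exact le_closure _ _ _
      (Or.inl ⟨f, hf, (isContinuous_techniques f hf).mono hS _ _ hts⟩)
  · refine closure_base_le (sup_le ?_ hST) hT'
    rintro t s ⟨g, hg, hts⟩
    exact hT' g hg _ _ ((isContinuous_techniques g hg).mono hST _ _ hts)
  · exact ((halfProgress_of_mem_techniques hf h hS hT hS' hT').clauses hts).mono hle le_rfl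
  · exact ((halfProgress_of_mem_techniques hf h.swap (fun _ _ h => hS _ _ h)
      (fun _ _ h => hT _ _ h) hS'.swap hT'.swap).clauses
        (technique_swap hf hts)).mono (fun _ _ h => hle _ _ h) le_rfl

theorem isStrongPart_base : IsStrongPart techniques baseTechniques :=
  ⟨baseTechniques_subset, fun _ => stronglyEvolves_of_mem_base,
    fun _ => evolves_of_mem_techniques⟩

theorem Steps.eq_of_normal {t u : Tm} (h : Steps t u) (ht : ∀ t', ¬ Step t t') : u = t := by
  rcases Relation.ReflTransGen.cases_head h with rfl | ⟨t', h, -⟩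
  · rfl
  · exact (ht t' h).elim

/-- The identity relation, together with one pair of distinct free variables. -/
def varPair : TmRel := fun t s => t = s ∨ t = .var 0 ∧ s = .var 1

/-- Passively, the values of `varPair` may be tested with an arbitrary relation. -/
theorem progress_varPair : Progress varPair ⊤ ⊤ := by
  have hS : StrongClosed ⊤ := fun _ _ => le_top
  have hT : FullyClosed ⊤ := fun _ _ => le_top
  refine ⟨le_top, le_rfl, .intro ?_, .intro ?_⟩
  · rintro t s (rfl | ⟨rfl, rfl⟩)
    · exact (halfProgress_refl (R := ⊤) hS hT).clauses (.mk t)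
    · exact .of_value .refl (.of_forall trivial trivial fun _ => trivial)
  · rintro t s (rfl | ⟨rfl, rfl⟩)
    · exact (halfProgress_refl (R := ⊤) hS.swap hT.swap).clauses (.mk _)
    · exact .of_value .refl (.of_forall trivial trivial fun _ => trivial)

/-- The context closures do not strongly evolve to anything: applied to `varPair`, which only
progresses passively, they relate stuck terms with distinct head variables. -/
theorem not_stronglyEvolves {f : RelFun}
    (hf : f ∈ ({utPctx, utPctxReset, utEctxPure} : Set RelFun)) (g h : RelFun) :
    ¬ StronglyEvolves f g h := by
  intro hev
  have hvar : varPair (.var 0) (.var 1) := Or.inr ⟨rfl, rfl⟩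
  have hE : ∀ z, z ∉ (ECtx.appL .hole .shift).fv := fun z => by simp [ECtx.fv, Tm.fv]
  have key : ∃ G : ECtx, f varPair (G.plug (.app (.var 0) .shift))
      (G.plug (.app (.var 1) .shift)) := by
    rcases hf with rfl | rfl | rfl
    · exact ⟨.hole, _, _, .appL .hole .shift, .appL .hole .shift, hvar, trivial, trivial,
        .pure_of_forall trivial trivial fun _ => Or.inl rfl⟩
    · exact ⟨.reset .hole, _, _, .appL .hole .shift, .appL .hole .shift, hvar, trivial, trivial,
        .reset_of_forall (F := .hole) (F' := .hole) trivial trivial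
          (fun _ => Or.inl rfl) fun _ => Or.inl rfl⟩
    · exact ⟨.hole, _, _, .appL .hole .shift, .appL .hole .shift, 0, hvar, trivial, trivial,
        hE 0, hE 0, Or.inl rfl⟩
  obtain ⟨G, hG⟩ := key
  have hsh : Tm.shift.IsValue := trivial
  obtain ⟨F', w, hs, -, hw⟩ :=
    ((hev _ _ _ progress_varPair).2.2.1.clauses hG).of_open_left hsh
  have e := hs.eq_of_normal (not_step_open G 1 hsh)
  exact absurd (open_plug_inj hw.2.1 hsh e).2.1 (by decide)

theorem strongTechniques_eq : strongTechniques = baseTechniques := by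
  ext f
  constructor
  · rintro ⟨hf, hf'⟩
    exact (mem_techniques_iff.1 hf).resolve_right hf'
  · intro hf
    exact ⟨baseTechniques_subset hf, fun hf' =>
      not_stronglyEvolves hf' _ _ (stronglyEvolves_of_mem_base hf)⟩

theorem isStrongPart_strongTechniques : IsStrongPart techniques strongTechniques :=
  strongTechniques_eq ▸ isStrongPart_base

theorem isGreatest_strongTechniques :
    IsGreatest {𝓢 | IsStrongPart techniques 𝓢} strongTechniques :=
  ⟨isStrongPart_strongTechniques, fun _ h𝓢 _ hf =>
    ⟨h𝓢.1 hf, fun hf' => not_stronglyEvolves hf' _ _ (h𝓢.2.1 _ hf)⟩⟩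

/-! ### Congruence and soundness of bisimilarity -/

theorem fullyClosed_bisim : FullyClosed Bisim :=
  fun _ hf => isStrongPart_base.apply_bisim_le isContinuous_techniques hf

theorem Bisim.symm {t s : Tm} (h : Bisim t s) : Bisim s t := by
  obtain ⟨R, hR, h⟩ := h
  exact ⟨Function.swap R, Progress.swap hR, h⟩

theorem Bisim.clauses {t s : Tm} (h : Bisim t s) : HalfClauses Bisim Bisim t s :=
  isBisimulation_bisim.2.2.1.clauses h

theorem Bisim.steps {t s t' : Tm} (h : Bisim t s) (ht : Steps t t') :
    ∃ s', Steps s s' ∧ Bisim t' s' := by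
  induction ht with
  | refl => exact ⟨s, .refl, h⟩
  | tail _ hst ih =>
    obtain ⟨s₁, hs₁, h₁⟩ := ih
    obtain ⟨s₂, hs₂, h₂⟩ := h₁.clauses.1 _ hst
    exact ⟨s₂, hs₁.trans hs₂, h₂⟩

/-- The composition of bisimilarity with itself is a bisimulation.  Two successive tests need not
use the same fresh variable, and are made to by the substitutivity of bisimilarity. -/
theorem Bisim.trans {t u s : Tm} (h : Bisim t u) (h' : Bisim u s) : Bisim t s := by
  have hX := fullyClosed_bisim.strong
  let C : TmRel := fun t s => ∃ u, Bisim t u ∧ Bisim u s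
  have hswap : Function.swap C = C := by
    funext t s
    exact propext ⟨fun ⟨u, h, h'⟩ => ⟨u, h'.symm, h.symm⟩, fun ⟨u, h, h'⟩ => ⟨u, h'.symm, h.symm⟩⟩
  have hval : ∀ {v w w'}, TestVal Bisim v w → TestVal Bisim w w' → TestVal C v w' :=
    fun h h' => .of_forall h.1 h'.2.1 fun x =>
      ⟨_, hX.app h (hX.testVal_refl trivial), hX.app h' (hX.testVal_refl trivial)⟩
  have hctx : ∀ {F F' F''}, TestCtx Bisim F F' → TestCtx Bisim F' F'' → TestCtx C F F'' := by
    intro F F' F'' h h'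
    rcases hX.testCtx_cases h with ⟨hE, hE', h⟩ | ⟨G, G', E, E', hE, hE', rfl, rfl, h, hG⟩
    · rcases hX.testCtx_cases h' with ⟨-, hE'', h'⟩ | ⟨_, _, _, _, -, -, rfl, -⟩
      · exact .pure_of_forall hE hE'' fun x => ⟨_, hX.plug_var h x, hX.plug_var h' x⟩
      · exact (ECtx.not_pure_comp_reset _ _ hE').elim
    · rcases hX.testCtx_cases h' with ⟨hP, -⟩ | ⟨H, H', P, P', hP, hP', e, rfl, h', hH⟩
      · exact (ECtx.not_pure_comp_reset _ _ hP).elim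
      · obtain ⟨rfl, rfl⟩ := ECtx.comp_reset_inj hE' hP e
        exact .reset_of_forall hE hP' (fun x => ⟨_, hX.plug_var h x, hX.plug_var h' x⟩)
          fun x => ⟨_, hX.plug_var hG x, hX.plug_var hH x⟩
  have hC : HalfProgress C C C := by
    refine .intro ?_
    rintro t s ⟨u, h, h'⟩
    rcases h.clauses.cases with ⟨t', u', ht, hu, h⟩ | ⟨w, hu, hw⟩ |
      ⟨F, F', y, v, w, rfl, hu, hF, hv⟩ |
      ⟨E, E', v, w, x, hE, hE', hv, hw, rfl, hu, hEE, hx, hx', h⟩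
    · obtain ⟨s', hs, h'⟩ := h'.steps hu
      exact .of_step ht hs ⟨u', h, h'⟩
    · obtain ⟨s', hs, h'⟩ := h'.steps hu
      obtain ⟨w', hs', hw'⟩ := h'.clauses.of_isValue hw.2.1
      exact .of_value (hs.trans hs') (hval hw hw')
    · obtain ⟨s', hs, h'⟩ := h'.steps hu
      obtain ⟨F'', w', hs', hF', hw'⟩ := h'.clauses.of_open_left hv.2.1
      exact .of_open (hs.trans hs') (hctx hF hF') (hval hv hw')
    · obtain ⟨s', hs, h'⟩ := h'.steps hu
      obtain ⟨E'', w', z, hE'', hw', hs', hEE', hz, hz', h'⟩ := h'.clauses.of_ctrl_left hE' hw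
      have h₁ := hX.plugRel_reset_appR hv hw hx hx' h
      have h₂ := hX.plugRel_reset_appR hw hw' hz hz' h'
      exact .of_ctrl (hs.trans hs') (.of_forall hE hE'' hv hw' (hctx hEE hEE')
        fun y => ⟨_, hX.plug_var h₁ y, hX.plug_var h₂ y⟩) hE hE'' hv hw'
  exact ⟨C, ⟨le_rfl, le_rfl, hC, by rwa [hswap]⟩, u, h, h'⟩

theorem FullyClosed.ctx {X : TmRel} (hX : FullyClosed X) (C : Ctx) {t s : Tm} (h : X t s) :
    X (C.plug t) (C.plug s) := by
  have hR := hX.strong.refl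
  induction C with
  | hole => exact h
  | lam x C ih => exact hX utLam (by simp [techniques]) _ _ ⟨x, _, _, ih⟩
  | appL C u ih =>
    exact hX.plug (F := .appL .hole u) (F' := .appL .hole u)
      (.pure_of_forall trivial trivial fun _ => hR _) ih
  | appR u C ih =>
    -- When `u` is not a value, `u □` is not an evaluation context.  The contexts `□ C[t]` and
    -- `□ C[s]` are related instead, because `x C[t]` and `x C[s]` are.
    refine hX.plug (F := .appL .hole (C.plug t)) (F' := .appL .hole (C.plug s))
      (.pure_of_forall trivial trivial fun x => ?_) (hR u)
    exact hX.plug (F := .appR (.var x) trivial .hole) (F' := .appR (.var x) trivial .hole)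
      (.pure_of_forall trivial trivial fun _ => hR _) ih
  | reset C ih =>
    exact hX.plug (F := .reset .hole) (F' := .reset .hole)
      (.reset_of_forall (F := .hole) (F' := .hole) trivial trivial (fun _ => hR _)
        fun _ => hR _) ih

theorem isCongruence_bisim : IsCongruence Bisim :=
  ⟨⟨fullyClosed_bisim.strong.refl, Bisim.symm, Bisim.trans⟩,
    fun C _ _ h => fullyClosed_bisim.ctx C h⟩

theorem Bisim.evalsTo {t s u : Tm} (h : Bisim t s) (hu : EvalsTo t u) :
    ∃ u', EvalsTo s u' ∧ (u.IsValue → u'.IsValue) ∧ (ControlStuck u → ControlStuck u') := by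
  obtain ⟨s', hs, h⟩ := h.steps hu.1
  rcases h.clauses.cases with ⟨t', _, ht, -⟩ | ⟨w, hu, hw⟩ |
    ⟨F, F', y, v, w, rfl, hu, hF, hv⟩ |
    ⟨E, E', v, w, x, hE, hE', hv, hw, rfl, hu, -⟩
  · exact (hu.2 t' ht).elim
  · refine ⟨w, ⟨hs.trans hu, not_step_of_isValue hw.2.1⟩, fun _ => hw.2.1, ?_⟩
    rintro ⟨E, v, -, -, rfl⟩
    exact (E.plug_not_isValue id hw.1).elim
  · refine ⟨_, ⟨hs.trans hu, not_step_open _ _ hv.2.1⟩,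
      fun h => (F.plug_not_isValue id h).elim, ?_⟩
    rintro ⟨E, v', -, hv', e⟩
    exact (open_plug_ne_ctrl hv.1 hv' e).elim
  · exact ⟨_, ⟨hs.trans hu, not_step_ctrl hE' hw⟩, fun h => (E.plug_not_isValue id h).elim,
      fun _ => ⟨E', w, hE', hw, rfl⟩⟩

theorem Bisim.ctxEquiv {t s : Tm} (h : Bisim t s) : CtxEquiv t s := by
  intro C _ _
  have h₁ := fullyClosed_bisim.ctx C h
  have h₂ := h₁.symm
  refine ⟨⟨?_, ?_⟩, ⟨?_, ?_⟩, ⟨?_, ?_⟩⟩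
  · rintro ⟨u, hu⟩
    obtain ⟨u', hu', -⟩ := h₁.evalsTo hu
    exact ⟨u', hu'⟩
  · rintro ⟨u, hu⟩
    obtain ⟨u', hu', -⟩ := h₂.evalsTo hu
    exact ⟨u', hu'⟩
  · rintro ⟨u, hv, hu⟩
    obtain ⟨u', hu', h, -⟩ := h₁.evalsTo hu
    exact ⟨u', h hv, hu'⟩
  · rintro ⟨u, hv, hu⟩
    obtain ⟨u', hu', h, -⟩ := h₂.evalsTo hu
    exact ⟨u', h hv, hu'⟩
  · rintro ⟨u, hv, hu⟩
    obtain ⟨u', hu', -, h⟩ := h₁.evalsTo hu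
    exact ⟨u', h hv, hu'⟩
  · rintro ⟨u, hv, hu⟩
    obtain ⟨u', hu', -, h⟩ := h₂.evalsTo hu
    exact ⟨u', h hv, hu'⟩

theorem utCtx_le_closure (R : TmRel) : utCtx R ≤ closure techniques R := by
  rintro _ _ ⟨C, t, s, h⟩
  exact (fullyClosed_closure R).ctx C (le_closure R _ _ h)

/-- The `η`-law: both terms, applied to a variable, are equal up to one reduction. -/
theorem bisim_eta {v : Tm} {x : ℕ} (hv : v.IsValue) (hx : x ∉ v.fv) :
    Bisim (Tm.abs x (.app v (.var x))) v := by
  let R : TmRel := fun t s => t = Tm.abs x (.app v (.var x)) ∧ s = v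
  have hX := strongClosed_closure R
  have hstep : ∀ z, Step (.app (Tm.abs x (.app v (.var x))) (.var z)) (.app v (.var z)) :=
    fun z => by
      have := step_abs_app x (.app v (.var x)) (v := .var z) trivial
      rwa [Tm.subst_app, Tm.subst_of_notMem hx, Tm.subst_var_self] at this
  refine isStrongPart_base.isStrongUpTo isContinuous_techniques (f := closure baseTechniques)
    (fun _ => le_rfl) R ⟨le_closure R, le_rfl, .intro ?_, .intro ?_⟩ _ _ ⟨rfl, rfl⟩
  · rintro _ _ ⟨rfl, rfl⟩
    exact .of_value .refl (.of_forall trivial hv fun z => hX.red (.single (hstep z)) .refl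
      (hX.refl _))
  · rintro _ _ ⟨rfl, rfl⟩
    exact .of_value .refl (.of_forall hv trivial fun z => hX.red (.single (hstep z)) .refl
      (hX.refl _))

end ShiftReset

theorem theoremt :
    -- the set of techniques is diacritically compatible, and the largest strong part is as claimed
    ShiftReset.DiacriticallyCompatible ShiftReset.techniques ∧
    IsGreatest {𝓢 | ShiftReset.IsStrongPart ShiftReset.techniques 𝓢}
      ShiftReset.strongTechniques ∧
    -- bisimulation up to the techniques, with only strong techniques in the passive clause
    (∀ R : ShiftReset.TmRel,
      ShiftReset.Progress R (ShiftReset.closure ShiftReset.strongTechniques R)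
        (ShiftReset.closure ShiftReset.techniques R) →
      ShiftReset.IsBisimulation (ShiftReset.closure ShiftReset.techniques R)) ∧
    (∀ f, ShiftReset.Generated ShiftReset.techniques f → ShiftReset.IsUpTo f) ∧
    (∀ f, ShiftReset.Generated ShiftReset.strongTechniques f → ShiftReset.IsStrongUpTo f) ∧
    (∀ f ∈ ShiftReset.techniques, f ShiftReset.Bisim ≤ ShiftReset.Bisim) ∧
    -- congruence and soundness of bisimilarity
    ShiftReset.IsCongruence ShiftReset.Bisim ∧
    (∀ t s : ShiftReset.Tm, ShiftReset.Bisim t s → ShiftReset.CtxEquiv t s) ∧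
    -- up to context is valid, and so is the law `λx.v x = v`
    (∀ R : ShiftReset.TmRel,
      ShiftReset.utCtx R ≤ ShiftReset.closure ShiftReset.techniques R) ∧
    ShiftReset.IsUpTo ShiftReset.utCtx ∧
    (∀ (v : ShiftReset.Tm) (x : ℕ), v.IsValue → x ∉ v.fv →
      ShiftReset.Bisim (ShiftReset.Tm.abs x (.app v (.var x))) v) := by

  have hc := ShiftReset.isContinuous_techniques
  have hS := ShiftReset.isStrongPart_strongTechniques
  have hcS : ∀ f ∈ ShiftReset.strongTechniques, ShiftReset.IsContinuous f :=
    fun f hf => hc f (hS.1 hf)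
  exact ⟨⟨hc, _, hS⟩, ShiftReset.isGreatest_strongTechniques, fun R => hS.isBisimulation hc,
    fun f hf => hS.isUpTo hc (hf.le_closure hc),
    fun f hf => hS.isStrongUpTo hc (hf.le_closure hcS),
    fun f hf => hS.apply_bisim_le hc hf, ShiftReset.isCongruence_bisim,
    fun t s h => h.ctxEquiv, ShiftReset.utCtx_le_closure,
    hS.isUpTo hc ShiftReset.utCtx_le_closure, fun v x hv hx => ShiftReset.bisim_eta hv hx⟩
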